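/- **Theorem.** An instance $I=(G,N,\mathcal U)$ of the connected fair division problem consists of a finite undirected graph $G=(V,E)$ whose vertices are called items, a finite set $N=\{1,\dots,n\}$ of players, and, for each $i\in N$, a utility function $u_i:V\to\mathbb Q_{\ge 0}$ with $\sum_{v\in V}u_i(v)=1$; put $u_i(X)=\sum_{v\in X}u_i(v)$ for $X\subseteq V$. A valid allocation assigns to each player $i$ a (possibly empty) set $\pi(i)\subseteq V$ that is connected in $G$, such that $\pi(i)\cap\pi(j)=\emptyset$ for $i\ne j$ (items may remain unallocated). It is proportional if $u_i(\pi(i))\ge \frac1n$ for all $i\in N$. The decision problem Prop-CFD asks whether a given instance $I$ admits a proportional valid allocation. Prop-CFD is solvable in polynomial time if $G$ is a star: there are an algorithm and a polynomial $T$ such that, on every instance $I$ whose graph $G$ is a star (that is, some vertex $c$ is adjacent to all other vertices and there are no other edges), the algorithm decides correctly whether $I$ admits a proportional valid allocation within time $T(|I|)$, where $|I|$ is the length of the encoding of $I$, with $G$ given by its adjacency matrix and the numerators and denominators of the utilities written in binary. (Time is measured on a random access machine with logarithmic cost, which is polynomially equivalent to a Turing machine.) -/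

import Mathlib

/-! ### Connected fair division -/

/-- An instance of the connected fair division problem: a graph on the items `0, …, m - 1`,
`n` players, and for each player a nonnegative rational utility function of total value `1`. -/
structure CFDInstance where
  n : ℕ
  m : ℕ
  G : SimpleGraph (Fin m)
  u : Fin n → Fin m → ℚ
  u_nonneg : ∀ i v, 0 ≤ u i v
  u_sum : ∀ i, ∑ v, u i v = 1

namespace CFDInstance

/-- An allocation assigns a bundle of items to each player. -/
abbrev Allocation (I : CFDInstance) : Type := Fin I.n → Finset (Fin I.m)

/-- Additive value of a bundle. -/
def value (I : CFDInstance) (i : Fin I.n) (X : Finset (Fin I.m)) : ℚ := ∑ v ∈ X, I.u i v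

/-- Every bundle is connected in `G` (the empty bundle is allowed), and no item is allocated
twice. Items may stay unallocated. -/
def IsValid (I : CFDInstance) (π : I.Allocation) : Prop :=
  (∀ i, (I.G.induce (π i : Set (Fin I.m))).Preconnected) ∧
    ∀ i j, i ≠ j → Disjoint (π i) (π j)

/-- Every player gets value at least `1 / n`. -/
def IsProportional (I : CFDInstance) (π : I.Allocation) : Prop :=
  ∀ i, 1 / (I.n : ℚ) ≤ I.value i (π i)

/-- The question asked by the decision problem Prop-CFD. -/
def PropCFD (I : CFDInstance) : Prop := ∃ π : I.Allocation, I.IsValid π ∧ I.IsProportional π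

/-- The graph of the instance is a star; the center can be any item. -/
def IsStar (I : CFDInstance) : Prop := ∃ c : Fin I.m, I.G = SimpleGraph.starGraph c

open Classical in
/-- The instance as a list of natural numbers: `n`, `m`, the adjacency matrix of `G` row by row,
and then, player by player and item by item, numerator and denominator of the utility. -/
noncomputable def encode (I : CFDInstance) : List ℕ :=
  [I.n, I.m] ++
    ((List.finRange I.m).flatMap fun v =>
      (List.finRange I.m).map fun w => if I.G.Adj v w then 1 else 0) ++
    ((List.finRange I.n).flatMap fun i =>
      (List.finRange I.m).flatMap fun v => [(I.u i v).num.toNat, (I.u i v).den])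

end CFDInstance

/-! ### Random access machines with logarithmic cost

Programs are while-programs acting on registers and on a memory that can be addressed indirectly;
all cells hold natural numbers. Every number and every address that is handled is charged its
binary length, so that running times agree with Turing machine times up to a polynomial. -/

namespace RAM

/-- Length of a natural number in binary, plus one. -/
def len (x : ℕ) : ℕ := Nat.size x + 1

structure State where
  reg : ℕ → ℕ
  mem : ℕ → ℕ

/-- Arithmetic operations; subtraction is truncated at `0`, division rounds down. -/
inductive Op where
  | add
  | sub
  | mul
  | div

def Op.eval : Op → ℕ → ℕ → ℕ
  | .add, x, y => x + y
  | .sub, x, y => x - y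
  | .mul, x, y => x * y
  | .div, x, y => x / y

/-- Expressions: constants, registers, the memory cell whose address is the value of an expression,
and arithmetic. -/
inductive Expr where
  | lit (k : ℕ)
  | reg (r : ℕ)
  | load (e : Expr)
  | bin (o : Op) (e₁ e₂ : Expr)

def Expr.eval (s : State) : Expr → ℕ
  | .lit k => k
  | .reg r => s.reg r
  | .load e => s.mem (e.eval s)
  | .bin o e₁ e₂ => o.eval (e₁.eval s) (e₂.eval s)

/-- Logarithmic cost of evaluating an expression. -/
def Expr.cost (s : State) : Expr → ℕ
  | .lit k => len k
  | .reg r => len r + len (s.reg r)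
  | .load e => e.cost s + len (e.eval s) + len (s.mem (e.eval s))
  | .bin _ e₁ e₂ => e₁.cost s + e₂.cost s + len (e₁.eval s) + len (e₂.eval s)

/-- Programs. A test `e` succeeds if the value of `e` is not `0`. -/
inductive Prog where
  | skip
  | assign (r : ℕ) (e : Expr)
  | store (a e : Expr)
  | seq (p q : Prog)
  | ite (e : Expr) (p q : Prog)
  | loop (e : Expr) (p : Prog)

def State.setReg (s : State) (r x : ℕ) : State := { s with reg := Function.update s.reg r x }

def State.setMem (s : State) (a x : ℕ) : State := { s with mem := Function.update s.mem a x }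

/-- `Exec p s t s'`: started in state `s`, the program `p` halts in state `s'`, and the whole
execution has logarithmic cost `t`. -/
inductive Exec : Prog → State → ℕ → State → Prop where
  | skip (s : State) : Exec .skip s 1 s
  | assign (r : ℕ) (e : Expr) (s : State) :
      Exec (.assign r e) s (e.cost s + len r + len (e.eval s)) (s.setReg r (e.eval s))
  | store (a e : Expr) (s : State) :
      Exec (.store a e) s (a.cost s + e.cost s + len (a.eval s) + len (e.eval s))
        (s.setMem (a.eval s) (e.eval s))
  | seq {p q : Prog} {s s' s'' : State} {t t' : ℕ} :
      Exec p s t s' → Exec q s' t' s'' → Exec (.seq p q) s (t + t') s''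
  | ite_true {e : Expr} {p q : Prog} {s s' : State} {t : ℕ} :
      e.eval s ≠ 0 → Exec p s t s' → Exec (.ite e p q) s (e.cost s + len (e.eval s) + t) s'
  | ite_false {e : Expr} {p q : Prog} {s s' : State} {t : ℕ} :
      e.eval s = 0 → Exec q s t s' → Exec (.ite e p q) s (e.cost s + len (e.eval s) + t) s'
  | loop_true {e : Expr} {p : Prog} {s s' s'' : State} {t t' : ℕ} :
      e.eval s ≠ 0 → Exec p s t s' → Exec (.loop e p) s' t' s'' →
        Exec (.loop e p) s (e.cost s + len (e.eval s) + t + t') s''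
  | loop_false {e : Expr} {p : Prog} {s : State} :
      e.eval s = 0 → Exec (.loop e p) s (e.cost s + len (e.eval s)) s

/-- Executions are deterministic: the final state and the cost are determined by the program and
the initial state. -/
theorem Exec.deterministic {p : Prog} {s s₁ s₂ : State} {t₁ t₂ : ℕ}
    (h₁ : Exec p s t₁ s₁) (h₂ : Exec p s t₂ s₂) : t₁ = t₂ ∧ s₁ = s₂ := by
  induction h₁ generalizing t₂ s₂ with
  | skip | assign | store => cases h₂; exact ⟨rfl, rfl⟩
  | seq _ _ ih ih' =>
    cases h₂ with
    | seq a b =>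
      obtain ⟨rfl, rfl⟩ := ih a
      obtain ⟨rfl, rfl⟩ := ih' b
      exact ⟨rfl, rfl⟩
  | ite_true h _ ih =>
    cases h₂ with
    | ite_true _ a => obtain ⟨rfl, rfl⟩ := ih a; exact ⟨rfl, rfl⟩
    | ite_false h' _ => exact absurd h' h
  | ite_false h _ ih =>
    cases h₂ with
    | ite_true h' _ => exact absurd h h'
    | ite_false _ a => obtain ⟨rfl, rfl⟩ := ih a; exact ⟨rfl, rfl⟩
  | loop_true h _ _ ih ih' =>
    cases h₂ with
    | loop_true _ a b =>
      obtain ⟨rfl, rfl⟩ := ih a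
      obtain ⟨rfl, rfl⟩ := ih' b
      exact ⟨rfl, rfl⟩
    | loop_false h' => exact absurd h' h
  | loop_false h =>
    cases h₂ with
    | loop_true h' _ _ => exact absurd h h'
    | loop_false _ => exact ⟨rfl, rfl⟩

/-- Initially the input list occupies the first memory cells; everything else is `0`. -/
def init (l : List ℕ) : State where
  reg := fun _ => 0
  mem := fun a => l.getD a 0

/-- Total binary length of an input list. -/
def inputSize (l : List ℕ) : ℕ := (l.map len).sum

/-- The decision problem `Q`, restricted to the inputs satisfying `D` and presented through the
encoding `enc`, is solvable in polynomial time: one program, with one polynomial time bound in the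
binary length of the input, halts on every input in `D` with the answer (`1` for yes, `0` for no)
in register `0`. -/
def SolvableInPolyTime {α : Type} (enc : α → List ℕ) (D Q : α → Prop) : Prop :=
  ∃ (p : Prog) (T : Polynomial ℕ), ∀ a, D a →
    ∃ (t : ℕ) (s : State), Exec p (init (enc a)) t s ∧ t ≤ T.eval (inputSize (enc a)) ∧
      (Q a → s.reg 0 = 1) ∧ (¬ Q a → s.reg 0 = 0)

end RAM

/-! ### Cost bounds for expressions of the random access machine -/

namespace RAM

/-! In a star, a connected set that avoids the center has at most one item. If n > 0, all bundles of
a proportional allocation are nonempty, so there is a player k (the owner) such that every other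
player holds exactly one leaf, worth at least 1/n to that player; the owner may as well take
everything that is left. Hence an allocation exists iff, for some k, the other players can be
matched to distinct leaves that they want and whose total value for k is at most 1 - 1/n
(`propCFD_iff`).

For fixed k this is a minimum-cost basis problem in a transversal matroid: the independent sets are
the sets of leaves that can be matched to players other than k, and the cost of a leaf is its value
for k. The greedy algorithm tries the leaves in order of increasing cost. Its optimality is proved
through Hall's condition. A rejected leaf yields a set of players that is tight for the chosen
leaves, unions of tight sets are tight (`IsGreedy.reject`), and a tight set shows that no matchable
set has more leaves of cost at most θ than the greedy one (`IsGreedy.card_filter_le`). Comparing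
these counts for all θ compares the total costs (`sum_le_sum_of_card_filter_le`).

Whether a leaf can be added is decided by pushing instead of searching for augmenting paths. The
leaf goes to a player of least height who wants it, that player's height grows by one, and the
displaced leaf is pushed next. Heights never exceed n, so n² pushes suffice. If the process is
blocked, a gap among the heights exhibits a violation of Hall's condition
(`Insertion.exists_card_lt`).

The program is written in a small language whose loops run only up to n or m, so it makes
polynomially many steps. In assignments a product always has an entry of the input as its second
factor, so lengths of numbers grow additively and not geometrically; this gives the polynomial bound
for the translated program (`exec_compile`). -/

theorem len_pos (x : ℕ) : 1 ≤ len x := Nat.le_add_left _ _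

theorem len_mono {x y : ℕ} (h : x ≤ y) : len x ≤ len y :=
  Nat.add_le_add_right (Nat.size_le_size h) 1

/-- The maximum, in place of the sum of the lengths, is what keeps lengths from doubling when
additions are iterated in a loop. -/
theorem len_add_le_max (x y : ℕ) : len (x + y) ≤ max (len x) (len y) + 1 := by
  unfold len
  have hx : x < 2 ^ max x.size y.size :=
    (Nat.lt_size_self x).trans_le (Nat.pow_le_pow_right (by norm_num) (le_max_left _ _))
  have hy : y < 2 ^ max x.size y.size :=
    (Nat.lt_size_self y).trans_le (Nat.pow_le_pow_right (by norm_num) (le_max_right _ _))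
  have : (x + y).size ≤ max x.size y.size + 1 := by
    rw [Nat.size_le, pow_succ]; omega
  omega

theorem len_mul_le (x y : ℕ) : len (x * y) ≤ len x + len y := by
  unfold len
  have : (x * y).size ≤ x.size + y.size := by
    rw [Nat.size_le, pow_add]
    exact Nat.mul_lt_mul'' (Nat.lt_size_self x) (Nat.lt_size_self y)
  omega

theorem len_le_add_one (x : ℕ) : len x ≤ x + 1 :=
  Nat.add_le_add_right (Nat.size_le.2 Nat.lt_two_pow_self) 1

theorem Op.len_eval_le (o : Op) (x y : ℕ) : len (o.eval x y) ≤ len x + len y := by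
  have hx := len_pos x
  have hy := len_pos y
  cases o
  · have := len_add_le_max x y
    simp only [Op.eval]; omega
  · exact (len_mono (Nat.sub_le x y)).trans (Nat.le_add_right _ _)
  · exact len_mul_le x y
  · exact (len_mono (Nat.div_le_self x y)).trans (Nat.le_add_right _ _)

/-- Every register and every memory cell holds a number of length at most `L`. -/
def State.Bounded (L : ℕ) (s : State) : Prop :=
  (∀ r, len (s.reg r) ≤ L) ∧ ∀ a, len (s.mem a) ≤ L

theorem State.Bounded.mono {L L' : ℕ} {s : State} (h : s.Bounded L) (hL : L ≤ L') :
    s.Bounded L' :=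
  ⟨fun r => (h.1 r).trans hL, fun a => (h.2 a).trans hL⟩

theorem State.Bounded.setReg {L : ℕ} {s : State} (h : s.Bounded L) {r x : ℕ} (hx : len x ≤ L) :
    (s.setReg r x).Bounded L := by
  refine ⟨fun q => ?_, h.2⟩
  by_cases hq : q = r
  · subst hq; simpa [State.setReg] using hx
  · simpa [State.setReg, hq] using h.1 q

theorem State.Bounded.setMem {L : ℕ} {s : State} (h : s.Bounded L) {a x : ℕ} (hx : len x ≤ L) :
    (s.setMem a x).Bounded L := by
  refine ⟨h.1, fun q => ?_⟩
  by_cases hq : q = a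
  · subst hq; simpa [State.setMem] using hx
  · simpa [State.setMem, hq] using h.2 q

/-- In a state bounded by `L` the value of an expression has length at most `L` times this. -/
def Expr.valueFactor : Expr → ℕ
  | .lit k => len k
  | .reg _ => 1
  | .load _ => 1
  | .bin _ e₁ e₂ => e₁.valueFactor + e₂.valueFactor

/-- In a state bounded by `L` evaluating an expression costs at most `L` times this. -/
def Expr.costFactor : Expr → ℕ
  | .lit k => len k
  | .reg r => len r + 1
  | .load e => e.costFactor + e.valueFactor + 1
  | .bin _ e₁ e₂ => e₁.costFactor + e₂.costFactor + e₁.valueFactor + e₂.valueFactor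

theorem Expr.len_eval_le {L : ℕ} {s : State} (hL : 1 ≤ L) (hs : s.Bounded L) (e : Expr) :
    len (e.eval s) ≤ e.valueFactor * L := by
  induction e with
  | lit k => exact Nat.le_mul_of_pos_right _ hL
  | reg r => simpa [Expr.eval, Expr.valueFactor] using hs.1 r
  | load e => simpa [Expr.eval, Expr.valueFactor] using hs.2 _
  | bin o e₁ e₂ h₁ h₂ =>
    simp only [Expr.eval, Expr.valueFactor, add_mul]
    exact (o.len_eval_le _ _).trans (add_le_add h₁ h₂)

theorem Expr.cost_le {L : ℕ} {s : State} (hL : 1 ≤ L) (hs : s.Bounded L) (e : Expr) :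
    e.cost s ≤ e.costFactor * L := by
  induction e with
  | lit k => exact Nat.le_mul_of_pos_right _ hL
  | reg r =>
    simp only [Expr.cost, Expr.costFactor, add_mul, one_mul]
    exact add_le_add (Nat.le_mul_of_pos_right _ hL) (hs.1 r)
  | load e h =>
    simp only [Expr.cost, Expr.costFactor, add_mul, one_mul]
    exact add_le_add (add_le_add h (e.len_eval_le hL hs)) (hs.2 _)
  | bin o e₁ e₂ h₁ h₂ =>
    simp only [Expr.cost, Expr.costFactor, add_mul]
    exact add_le_add (add_le_add (add_le_add h₁ h₂) (e₁.len_eval_le hL hs)) (e₂.len_eval_le hL hs)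

end RAM

/-! ### A structured language with named variables, arrays and bounded loops -/

namespace StarCFD

open RAM

/-- Scalar variables. -/
inductive Var where
  | answer | center | degree | owner | round | item | player | best | current | outer | inner
  | level | partner | displaced | numer | denom | count
  deriving DecidableEq

/-- Arrays. -/
inductive Arr where
  | holding | height | backup | done
  deriving DecidableEq

def Var.idx : Var → ℕ
  | answer => 0 | center => 1 | degree => 2 | owner => 3 | round => 4 | item => 5 | player => 6
  | best => 7 | current => 8 | outer => 9 | inner => 10 | level => 11 | partner => 12
  | displaced => 13 | numer => 14 | denom => 15 | count => 16

theorem Var.idx_injective : Function.Injective Var.idx := by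
  have : Function.LeftInverse (fun k : ℕ => match k with
    | 0 => answer | 1 => center | 2 => degree | 3 => owner | 4 => round | 5 => item | 6 => player
    | 7 => best | 8 => current | 9 => outer | 10 => inner | 11 => level | 12 => partner
    | 13 => displaced | 14 => numer | 15 => denom | _ => count) Var.idx := by
    intro x; cases x <;> rfl
  exact this.injective

def Arr.idx : Arr → ℕ
  | holding => 0 | height => 1 | backup => 2 | done => 3

theorem Arr.idx_injective : Function.Injective Arr.idx := by
  intro a b; cases a <;> cases b <;> simp [Arr.idx]

theorem Arr.idx_lt (a : Arr) : a.idx < 4 := by cases a <;> simp [Arr.idx]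

/-- The two quantities that can bound a loop. -/
inductive Bound where
  | players | items

/-- The read-only part of a computation: the two loop bounds and the input. -/
structure Env where
  n : ℕ
  m : ℕ
  input : List ℕ

/-- Reading the input; addresses out of range are replaced by `0`. -/
def Env.read (E : Env) (a : ℕ) : ℕ := E.input.getD (if a < E.input.length then a else 0) 0

def Bound.val (E : Env) : Bound → ℕ
  | players => E.n
  | items => E.m

def Bound.idx : Bound → ℕ
  | players => 1
  | items => 2

/-- The variable part of a computation. -/
structure Store where
  var : Var → ℕ
  arr : Arr → ℕ → ℕ

def Store.setVar (h : Store) (x : Var) (k : ℕ) : Store :=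
  { h with var := Function.update h.var x k }

def Store.setArr (h : Store) (a : Arr) (i k : ℕ) : Store :=
  { h with arr := Function.update h.arr a (Function.update (h.arr a) i k) }

@[simp] theorem Store.setVar_var (h : Store) (x : Var) (k : ℕ) (y : Var) :
    (h.setVar x k).var y = if y = x then k else h.var y := by
  simp [Store.setVar, Function.update_apply]

@[simp] theorem Store.setVar_arr (h : Store) (x : Var) (k : ℕ) : (h.setVar x k).arr = h.arr := rfl

@[simp] theorem Store.setArr_var (h : Store) (a : Arr) (i k : ℕ) : (h.setArr a i k).var = h.var :=
  rfl

@[simp] theorem Store.setArr_arr (h : Store) (a : Arr) (i k : ℕ) (b : Arr) :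
    (h.setArr a i k).arr b = if b = a then Function.update (h.arr a) i k else h.arr b := by
  by_cases hb : b = a
  · subst hb; simp [Store.setArr]
  · simp [Store.setArr, hb]

inductive SExpr where
  | lit (k : ℕ)
  | bound (b : Bound)
  | var (x : Var)
  | inp (e : SExpr)
  | arr (a : Arr) (e : SExpr)
  | bin (o : Op) (e₁ e₂ : SExpr)

def SExpr.eval (E : Env) (h : Store) : SExpr → ℕ
  | .lit k => k
  | .bound b => b.val E
  | .var x => h.var x
  | .inp e => E.read (e.eval E h)
  | .arr a e => h.arr a (e.eval E h)
  | .bin o e₁ e₂ => o.eval (e₁.eval E h) (e₂.eval E h)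

inductive SProg where
  | skip
  | set (x : Var) (e : SExpr)
  | store (a : Arr) (i e : SExpr)
  | seq (p q : SProg)
  | ite (e : SExpr) (p q : SProg)
  | upTo (x : Var) (b : Bound) (p : SProg)

namespace SProg

/-- The store after running a program. In `upTo x b p` the variable `x` runs from `0` to `b - 1`. -/
def run (E : Env) : SProg → Store → Store
  | .skip, h => h
  | .set x e, h => h.setVar x (e.eval E h)
  | .store a i e, h => h.setArr a (i.eval E h) (e.eval E h)
  | .seq p q, h => q.run E (p.run E h)
  | .ite e p q, h => if e.eval E h ≠ 0 then p.run E h else q.run E h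
  | .upTo x b p, h =>
      (fun h' => (p.run E h').setVar x ((p.run E h').var x + 1))^[b.val E] (h.setVar x 0)

theorem run_ite_pos {E : Env} {e : SExpr} {h : Store} (he : e.eval E h ≠ 0) (p q : SProg) :
    (ite e p q).run E h = p.run E h := if_pos he

theorem run_ite_neg {E : Env} {e : SExpr} {h : Store} (he : e.eval E h = 0) (p q : SProg) :
    (ite e p q).run E h = q.run E h := if_neg (not_not.2 he)

/-- Variables that a program may change. -/
def vars : SProg → List Var
  | .skip => []
  | .set x _ => [x]
  | .store _ _ _ => []
  | .seq p q => p.vars ++ q.vars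
  | .ite _ p q => p.vars ++ q.vars
  | .upTo x _ p => x :: p.vars

/-- Arrays that a program may change. -/
def arrs : SProg → List Arr
  | .skip => []
  | .set _ _ => []
  | .store a _ _ => [a]
  | .seq p q => p.arrs ++ q.arrs
  | .ite _ p q => p.arrs ++ q.arrs
  | .upTo _ _ p => p.arrs

theorem run_var_of_notMem (E : Env) {p : SProg} {y : Var} (hy : y ∉ p.vars) (h : Store) :
    (p.run E h).var y = h.var y := by
  induction p generalizing h with
  | skip => rfl
  | set x e => simp_all [run, vars]
  | store a i e => simp [run]
  | seq p q hp hq =>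
    simp only [vars, List.mem_append, not_or] at hy
    rw [run, hq hy.2, hp hy.1]
  | ite e p q hp hq =>
    simp only [vars, List.mem_append, not_or] at hy
    rw [run]; split_ifs
    exacts [hp hy.1 h, hq hy.2 h]
  | upTo x b p hp =>
    simp only [vars, List.mem_cons, not_or] at hy
    rw [run]
    generalize b.val E = N
    induction N with
    | zero => simp [hy.1]
    | succ N ih => rw [Function.iterate_succ_apply', Store.setVar_var, if_neg hy.1, hp hy.2, ih]

theorem run_arr_of_notMem (E : Env) {p : SProg} {a : Arr} (ha : a ∉ p.arrs) (h : Store) :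
    (p.run E h).arr a = h.arr a := by
  induction p generalizing h with
  | skip => rfl
  | set x e => simp [run]
  | store a i e => simp_all [run, arrs]
  | seq p q hp hq =>
    simp only [arrs, List.mem_append, not_or] at ha
    rw [run, hq ha.2, hp ha.1]
  | ite e p q hp hq =>
    simp only [arrs, List.mem_append, not_or] at ha
    rw [run]; split_ifs
    exacts [hp ha.1 h, hq ha.2 h]
  | upTo x b p hp =>
    rw [run]
    generalize b.val E = N
    induction N with
    | zero => simp
    | succ N ih => rw [Function.iterate_succ_apply', Store.setVar_arr, hp ha, ih]

/-- Induction principle for loops; what the body of the loop does not change stays the same. -/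
theorem run_upTo_induction (E : Env) {x : Var} {b : Bound} {p : SProg} (hx : x ∉ p.vars)
    (inv : ℕ → Store → Prop) (h : Store) (h₀ : inv 0 (h.setVar x 0))
    (step : ∀ j h', j < b.val E → h'.var x = j → (∀ y ∉ x :: p.vars, h'.var y = h.var y) →
      (∀ a ∉ p.arrs, h'.arr a = h.arr a) → inv j h' →
      inv (j + 1) ((p.run E h').setVar x (j + 1))) :
    inv (b.val E) ((upTo x b p).run E h) := by
  rw [run]
  suffices ∀ N ≤ b.val E, ∀ h', h' = (fun h' => (p.run E h').setVar x ((p.run E h').var x + 1))^[N]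
      (h.setVar x 0) → h'.var x = N ∧ (∀ y ∉ x :: p.vars, h'.var y = h.var y) ∧
      (∀ a ∉ p.arrs, h'.arr a = h.arr a) ∧ inv N h' from (this _ le_rfl _ rfl).2.2.2
  intro N
  induction N with
  | zero =>
    rintro - h' rfl
    refine ⟨by simp, fun y hy => ?_, fun a _ => rfl, h₀⟩
    have : y ≠ x := fun h => hy (h ▸ List.mem_cons_self)
    simp [this]
  | succ N ih =>
    rintro hN h' rfl
    obtain ⟨h₁, h₂, h₃, h₄⟩ := ih (by omega) _ rfl
    rw [Function.iterate_succ_apply', run_var_of_notMem E hx, h₁]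
    refine ⟨by simp, fun y hy => ?_, fun a ha => ?_, step N _ (by omega) h₁ h₂ h₃ h₄⟩
    · rw [← h₂ y hy]
      simp only [List.mem_cons, not_or] at hy
      rw [Store.setVar_var, if_neg hy.1, run_var_of_notMem E hy.2]
    · rw [← h₃ a ha, Store.setVar_arr, run_arr_of_notMem E ha]

end SProg

/-! ### Translation to the random access machine -/

/-- Address of entry `i` of the array `a`; register `3` holds the length of the input. -/
def arrAddr (a : Arr) (i : Expr) : Expr :=
  .bin .add (.reg 3) (.bin .add (.bin .mul (.lit 4) i) (.lit a.idx))

def SExpr.compile : SExpr → Expr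
  | .lit k => .lit k
  | .bound b => .reg b.idx
  | .var x => .reg (x.idx + 4)
  -- The second factor is 1 if the address lies in the input and 0 otherwise. Without this guard an
  -- address beyond the input would read the cells that hold the arrays.
  | .inp e => .load (.bin .mul e.compile
      (.bin .sub (.lit 1) (.bin .sub (.bin .add e.compile (.lit 1)) (.reg 3))))
  | .arr a e => .load (arrAddr a e.compile)
  | .bin o e₁ e₂ => .bin o e₁.compile e₂.compile

def SProg.compile : SProg → Prog
  | .skip => .skip
  | .set x e => .assign (x.idx + 4) e.compile
  | .store a i e => .store (arrAddr a i.compile) e.compile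
  | .seq p q => .seq p.compile q.compile
  | .ite e p q => .ite e.compile p.compile q.compile
  | .upTo x b p => .seq (.assign (x.idx + 4) (.lit 0))
      (.loop (.bin .sub (.reg b.idx) (.reg (x.idx + 4)))
        (.seq p.compile (.assign (x.idx + 4) (.bin .add (.reg (x.idx + 4)) (.lit 1)))))

/-- The machine state `s` represents the environment `E` and the store `h`. -/
structure Represents (E : Env) (h : Store) (s : State) : Prop where
  bound : ∀ b : Bound, s.reg b.idx = b.val E
  length : s.reg 3 = E.input.length
  var : ∀ x : Var, s.reg (x.idx + 4) = h.var x
  input : ∀ a < E.input.length, s.mem a = E.input.getD a 0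
  arr : ∀ (a : Arr) (i : ℕ), s.mem (E.input.length + (4 * i + a.idx)) = h.arr a i

/-- The input has to be nonempty because reads out of range are redirected to cell 0, which must
then be an input cell. -/
theorem Represents.eval_compile {E : Env} {h : Store} {s : State} (hs : Represents E h s)
    (hE : 0 < E.input.length) (e : SExpr) : e.compile.eval s = e.eval E h := by
  induction e with
  | lit k => rfl
  | bound b => exact hs.bound b
  | var x => exact hs.var x
  | inp e ih =>
    simp only [SExpr.compile, Expr.eval, SExpr.eval, Op.eval, ih, hs.length, Env.read]
    split_ifs with hlt
    · rw [show e.eval E h + 1 - E.input.length = 0 by omega, Nat.sub_zero, mul_one]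
      exact hs.input _ hlt
    · rw [show 1 - (e.eval E h + 1 - E.input.length) = 0 by omega, mul_zero]
      exact hs.input _ hE
  | arr a e ih =>
    simp only [SExpr.compile, arrAddr, Expr.eval, SExpr.eval, Op.eval, ih, hs.length]
    exact hs.arr a _
  | bin o e₁ e₂ h₁ h₂ => simp only [SExpr.compile, Expr.eval, SExpr.eval, h₁, h₂]

theorem Represents.setVar {E : Env} {h : Store} {s : State} (hs : Represents E h s) (x : Var)
    (k : ℕ) : Represents E (h.setVar x k) (s.setReg (x.idx + 4) k) where
  bound b := by
    have : b.idx ≠ x.idx + 4 := by cases b <;> simp only [Bound.idx] <;> omega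
    simpa [State.setReg, this] using hs.bound b
  length := by
    have : 3 ≠ x.idx + 4 := by omega
    simpa [State.setReg, this] using hs.length
  var y := by
    by_cases hy : y = x
    · subst hy; simp [State.setReg]
    · have : y.idx ≠ x.idx := fun h => hy (Var.idx_injective h)
      simpa [State.setReg, this, hy] using hs.var y
  input := hs.input
  arr := hs.arr

/-- The four arrays are interleaved behind the input: the residue modulo 4 of the offset identifies
the array and the quotient identifies the index, so a write touches one entry only and never the
input. -/
theorem Represents.setArr {E : Env} {h : Store} {s : State} (hs : Represents E h s) (a : Arr)
    (i k : ℕ) :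
    Represents E (h.setArr a i k) (s.setMem (E.input.length + (4 * i + a.idx)) k) where
  bound := hs.bound
  length := hs.length
  var := hs.var
  input q hq := by
    have : q ≠ E.input.length + (4 * i + a.idx) := by omega
    simpa [State.setMem, this] using hs.input q hq
  arr b j := by
    have ha := a.idx_lt
    have hb := b.idx_lt
    have key : 4 * j + b.idx = 4 * i + a.idx ↔ b = a ∧ j = i := by
      constructor
      · intro h
        have : b.idx = a.idx := by omega
        exact ⟨Arr.idx_injective this, by omega⟩
      · rintro ⟨rfl, rfl⟩; rfl
    by_cases hba : b = a
    · subst hba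
      by_cases hj : j = i
      · subst hj; simp [State.setMem]
      · simpa [State.setMem, hj] using hs.arr b j
    · simpa [State.setMem, Function.update_apply, key, hba] using hs.arr b j

/-! ### Polynomial time bound for translated programs -/

/-- Expressions whose value is longer than the longest number of the store only by a bounded
multiple of the length of the longest number in the input. -/
def SExpr.tame : SExpr → Bool
  | .lit _ => true
  | .bound _ => true
  | .var _ => true
  | .inp _ => true
  | .arr _ _ => true
  | .bin .add e₁ e₂ => e₁.tame && e₂.tame
  | .bin .sub e₁ _ => e₁.tame
  | .bin .div e₁ _ => e₁.tame
  | .bin .mul e₁ (.inp _) => e₁.tame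
  | .bin .mul _ _ => false

/-- The excess of the length of a value over the bound for the store, counted in units of the bound
`D` for the entries of the input. One unit per operation covers both the carry of an addition and a
factor taken from the input. -/
def SExpr.gain : SExpr → ℕ
  | .lit k => len k
  | .bound _ => 0
  | .var _ => 0
  | .inp _ => 0
  | .arr _ _ => 0
  | .bin _ e₁ e₂ => e₁.gain + e₂.gain + 1

/-- Variables, array entries and input entries sit in machine cells, hence have length at most `L`.
A sum costs one extra digit, a factor from the input at most `D` digits, and differences and
quotients are no longer than their first operand. -/
theorem len_eval_le_of_tame {E : Env} {h : Store} {s : State} {L D : ℕ}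
    (hs : Represents E h s) (hE : 0 < E.input.length) (hL : s.Bounded L) (hD : 1 ≤ D)
    (hin : ∀ k, len (E.input.getD k 0) ≤ D) (e : SExpr) (he : e.tame = true) :
    len (e.eval E h) ≤ L + e.gain * D := by
  induction e with
  | lit k =>
    exact (Nat.le_mul_of_pos_right (len k) hD).trans (Nat.le_add_left _ _)
  | bound b => simpa [SExpr.eval, SExpr.gain, ← hs.bound b] using hL.1 _
  | var x => simpa [SExpr.eval, SExpr.gain, ← hs.var x] using hL.1 _
  | inp e =>
    rw [← hs.eval_compile hE]
    exact (hL.2 _).trans (Nat.le_add_right _ _)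
  | arr a e =>
    rw [← hs.eval_compile hE]
    exact (hL.2 _).trans (Nat.le_add_right _ _)
  | bin o e₁ e₂ h₁ h₂ =>
    have hsum : L + (SExpr.bin o e₁ e₂).gain * D = L + e₁.gain * D + e₂.gain * D + D := by
      simp only [SExpr.gain]; ring
    rw [hsum]
    cases o with
    | add =>
      simp only [SExpr.tame, Bool.and_eq_true] at he
      have h₁ := h₁ he.1
      have h₂ := h₂ he.2
      have := len_add_le_max (e₁.eval E h) (e₂.eval E h)
      simp only [SExpr.eval, Op.eval]
      generalize e₁.gain * D = x at *
      generalize e₂.gain * D = y at *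
      omega
    | sub =>
      have := len_mono (Nat.sub_le (e₁.eval E h) (e₂.eval E h))
      exact this.trans ((h₁ he).trans (by omega))
    | div =>
      have := len_mono (Nat.div_le_self (e₁.eval E h) (e₂.eval E h))
      exact this.trans ((h₁ he).trans (by omega))
    | mul =>
      cases e₂ with
      | inp e =>
        have h₂ : len ((SExpr.inp e).eval E h) ≤ D := hin _
        have := len_mul_le (e₁.eval E h) ((SExpr.inp e).eval E h)
        have h₁ := h₁ he
        simp only [SExpr.eval, Op.eval] at *
        omega
      | _ => simp [SExpr.tame] at he

namespace SProg

/-- Syntactic conditions for the time bound: all assigned values are tame, and loop variables are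
not changed in the body of the loop. -/
def wellFormed : SProg → Bool
  | .skip => true
  | .set _ e => e.tame
  | .store _ _ e => e.tame
  | .seq p q => p.wellFormed && q.wellFormed
  | .ite _ p q => p.wellFormed && q.wellFormed
  | .upTo x _ p => decide (x ∉ p.vars) && p.wellFormed

open Polynomial in
/-- Growth of the numbers in the store, as a polynomial in the loop bounds. -/
noncomputable def growth : SProg → ℕ[X]
  | .skip => 0
  | .set _ e => e.gain
  | .store _ _ e => e.gain
  | .seq p q => p.growth + q.growth
  | .ite _ p q => p.growth + q.growth
  | .upTo _ _ p => 1 + X * (p.growth + 1)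

open Polynomial in
/-- Time per length of the numbers, as a polynomial in the loop bounds. -/
noncomputable def time : SProg → ℕ[X]
  | .skip => 1
  | .set x e => (e.compile.costFactor + len (x.idx + 4) + e.compile.valueFactor : ℕ)
  | .store a i e =>
      ((arrAddr a i.compile).costFactor + e.compile.costFactor +
        (arrAddr a i.compile).valueFactor + e.compile.valueFactor : ℕ)
  | .seq p q => p.time + q.time
  | .ite e p q => ((e.compile.costFactor + e.compile.valueFactor : ℕ) : ℕ[X]) + p.time + q.time
  | .upTo x b p =>
      let c : ℕ := (Expr.bin .sub (.reg b.idx) (.reg (x.idx + 4))).costFactor + 2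
      let d : ℕ := (Expr.bin .add (.reg (x.idx + 4)) (.lit 1)).costFactor + len (x.idx + 4) + 3
      ((len (x.idx + 4) + 2 + c : ℕ) : ℕ[X]) + X * (((c + d : ℕ) : ℕ[X]) + p.time)

end SProg

/-- Here `N` is the number of iterations still to come. One iteration raises the length bound by `(g
+ 1) * D`: the body accounts for `g` and the increment of the counter for 1. Since the bounds only
increase, every iteration can be charged at the final one. -/
theorem exec_loop {E : Env} {N D : ℕ} (hD : 1 ≤ D) (x : Var) (b : Bound)
    (p : SProg) (hx : x ∉ p.vars) (g τ : ℕ)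
    (hp : ∀ (h : Store) (s : State) (L : ℕ), 1 ≤ L → Represents E h s → s.Bounded L →
      ∃ t s', Exec p.compile s t s' ∧ Represents E (p.run E h) s' ∧ s'.Bounded (L + g * D) ∧
        t ≤ τ * (L + g * D)) (hN : N ≤ b.val E) :
    ∀ (h : Store) (s : State) (L : ℕ), 1 ≤ L → Represents E h s → s.Bounded L →
      h.var x + N = b.val E →
      ∃ t s', Exec (.loop (.bin .sub (.reg b.idx) (.reg (x.idx + 4)))
        (.seq p.compile (.assign (x.idx + 4) (.bin .add (.reg (x.idx + 4)) (.lit 1))))) s t s' ∧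
        Represents E ((fun h' => (p.run E h').setVar x ((p.run E h').var x + 1))^[N] h) s' ∧
        s'.Bounded (L + N * (g + 1) * D) ∧
        t ≤ ((Expr.bin .sub (.reg b.idx) (.reg (x.idx + 4))).costFactor + 2 +
          N * ((Expr.bin .sub (.reg b.idx) (.reg (x.idx + 4))).costFactor + 2 +
            ((Expr.bin .add (.reg (x.idx + 4)) (.lit 1)).costFactor + len (x.idx + 4) + 3) + τ)) *
          (L + N * (g + 1) * D) := by
  set test : Expr := .bin .sub (.reg b.idx) (.reg (x.idx + 4)) with htest
  set incr : Expr := .bin .add (.reg (x.idx + 4)) (.lit 1) with hincr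
  have htestL : ∀ {L : ℕ} {s : State}, 1 ≤ L → s.Bounded L →
      test.cost s + len (test.eval s) ≤ (test.costFactor + 2) * L := by
    intro L s hL hs
    rw [add_mul]
    exact add_le_add (test.cost_le hL hs) (test.len_eval_le hL hs)
  induction N with
  | zero =>
    intro h s L hL hs hb hv
    have hev : test.eval s = 0 := by
      simp only [htest, Expr.eval, Op.eval, hs.bound, hs.var]; omega
    refine ⟨_, s, .loop_false hev, by simpa using hs, by simpa using hb, ?_⟩
    simpa using htestL hL hb
  | succ N ih =>
    intro h s L hL hs hb hv
    have hev : test.eval s ≠ 0 := by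
      simp only [htest, Expr.eval, Op.eval, hs.bound, hs.var]; omega
    obtain ⟨t₁, s₁, hex₁, hr₁, hb₁, ht₁⟩ := hp h s L hL hs hb
    have hvx : (p.run E h).var x = h.var x := SProg.run_var_of_notMem E hx h
    have hincv : incr.eval s₁ = (p.run E h).var x + 1 := by
      simp [hincr, Expr.eval, Op.eval, hr₁.var]
    have hL₁ : 1 ≤ L + g * D := by omega
    have hlen : len (incr.eval s₁) ≤ L + (g + 1) * D := by
      have h1 := len_add_le_max (s₁.reg (x.idx + 4)) 1
      have h2 := hb₁.1 (x.idx + 4)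
      have h3 : len 1 = 2 := by simp [len]
      have h4 : incr.eval s₁ = s₁.reg (x.idx + 4) + 1 := rfl
      have h5 : (g + 1) * D = g * D + D := by ring
      have h6 : 2 ≤ max (len (s₁.reg (x.idx + 4))) 2 := le_max_right _ _
      rw [h4, h5]
      -- At 0 the maximum in `len_add_le_max` is attained by `len 1 = 2`, which may exceed the old
      -- bound, so this case is done directly.
      rcases Nat.eq_zero_or_pos (s₁.reg (x.idx + 4)) with h0 | h0
      · rw [h0, zero_add, h3]; omega
      · have : 2 ≤ len (s₁.reg (x.idx + 4)) := h3 ▸ len_mono h0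
        rw [h3] at h1
        omega
    have hle : L + g * D ≤ L + (g + 1) * D :=
      Nat.add_le_add_left (Nat.mul_le_mul_right _ (Nat.le_succ g)) _
    have hr₂ := hr₁.setVar x ((p.run E h).var x + 1)
    have hb₂ := (hb₁.mono hle).setReg (r := x.idx + 4) hlen
    rw [← hincv] at hr₂
    obtain ⟨t₂, s₂, hex₂, hr₃, hb₃, ht₂⟩ := ih (by omega) _ _ (L + (g + 1) * D) (by omega) hr₂
      hb₂ (by simp only [Store.setVar_var, if_true, hincv, hvx]; omega)
    refine ⟨_, s₂, .loop_true hev (.seq hex₁ (.assign _ _ _)) hex₂, ?_, ?_, ?_⟩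
    · rw [Function.iterate_succ_apply]; rwa [hincv] at hr₃
    · convert hb₃ using 1; ring
    · have e1 : L + (g + 1) * D + N * (g + 1) * D = L + (N + 1) * (g + 1) * D := by ring
      rw [e1] at ht₂
      set M := L + (N + 1) * (g + 1) * D with hM
      have m1 : L ≤ M := Nat.le_add_right _ _
      have m2 : L + (g + 1) * D ≤ M := by
        rw [← e1]; exact Nat.le_add_right _ _
      have m3 : L + g * D ≤ M := hle.trans m2
      have c1 := (htestL hL hb).trans (Nat.mul_le_mul_left _ m1)
      have c2 := ht₁.trans (Nat.mul_le_mul_left _ m3)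
      have c3 := (incr.cost_le hL₁ hb₁).trans (Nat.mul_le_mul_left _ m3)
      have c4 : len (x.idx + 4) ≤ len (x.idx + 4) * M := Nat.le_mul_of_pos_right _ (by omega)
      have c5 := hlen.trans m2
      have hgoal : (test.costFactor + 2 + (N + 1) * (test.costFactor + 2 +
          (incr.costFactor + len (x.idx + 4) + 3) + τ)) * M =
          (test.costFactor + 2) * M + τ * M + incr.costFactor * M + len (x.idx + 4) * M + 3 * M +
          (test.costFactor + 2 + N * (test.costFactor + 2 +
          (incr.costFactor + len (x.idx + 4) + 3) + τ)) * M := by ring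
      rw [hgoal]
      omega

/-- A well-formed program can be simulated by a machine, with a polynomial time bound. -/
theorem exec_compile {E : Env} {N D : ℕ} (hE : 0 < E.input.length) (hn : ∀ b : Bound, b.val E ≤ N)
    (hD : 1 ≤ D) (hin : ∀ k, len (E.input.getD k 0) ≤ D) (p : SProg) (hp : p.wellFormed = true) :
    ∀ (h : Store) (s : State) (L : ℕ), 1 ≤ L → Represents E h s → s.Bounded L →
      ∃ t s', Exec p.compile s t s' ∧ Represents E (p.run E h) s' ∧
        s'.Bounded (L + p.growth.eval N * D) ∧ t ≤ p.time.eval N * (L + p.growth.eval N * D) := by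
  induction p with
  | skip =>
    intro h s L hL hs hb
    refine ⟨_, s, .skip s, hs, by simpa [SProg.growth] using hb, ?_⟩
    simpa [SProg.time, SProg.growth] using hL
  | set x e =>
    intro h s L hL hs hb
    have hlen := len_eval_le_of_tame hs hE hb hD hin e hp
    have hg : ((SProg.set x e).growth.eval N) = e.gain := by simp [SProg.growth]
    rw [hg]
    rw [← hs.eval_compile hE] at hlen
    have hle : L ≤ L + e.gain * D := Nat.le_add_right _ _
    refine ⟨_, _, .assign _ _ _, ?_, (hb.mono hle).setReg hlen, ?_⟩
    · rw [SProg.run, ← hs.eval_compile hE]; exact hs.setVar x _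
    · have c1 := (e.compile.cost_le hL hb).trans (Nat.mul_le_mul_left _ hle)
      have c2 := (e.compile.len_eval_le hL hb).trans (Nat.mul_le_mul_left _ hle)
      have c3 : len (x.idx + 4) ≤ len (x.idx + 4) * (L + e.gain * D) :=
        Nat.le_mul_of_pos_right _ (by omega)
      simp only [SProg.time, Polynomial.eval_natCast, Nat.cast_id, add_mul] at c1 c2 c3 ⊢
      omega
  | store a i e =>
    intro h s L hL hs hb
    have hlen := len_eval_le_of_tame hs hE hb hD hin e hp
    have hg : ((SProg.store a i e).growth.eval N) = e.gain := by simp [SProg.growth]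
    rw [hg]
    rw [← hs.eval_compile hE] at hlen
    have hle : L ≤ L + e.gain * D := Nat.le_add_right _ _
    refine ⟨_, _, .store _ _ _, ?_, (hb.mono hle).setMem hlen, ?_⟩
    · have haddr : (arrAddr a i.compile).eval s = E.input.length + (4 * i.eval E h + a.idx) := by
        simp [arrAddr, Expr.eval, Op.eval, hs.length, hs.eval_compile hE]
      rw [SProg.run, ← hs.eval_compile hE e, haddr]; exact hs.setArr a _ _
    · have c1 := (e.compile.cost_le hL hb).trans (Nat.mul_le_mul_left _ hle)
      have c2 := (e.compile.len_eval_le hL hb).trans (Nat.mul_le_mul_left _ hle)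
      have c3 := ((arrAddr a i.compile).cost_le hL hb).trans (Nat.mul_le_mul_left _ hle)
      have c4 := ((arrAddr a i.compile).len_eval_le hL hb).trans (Nat.mul_le_mul_left _ hle)
      simp only [SProg.time, Polynomial.eval_natCast, Nat.cast_id, add_mul] at c1 c2 c3 c4 ⊢
      omega
  | seq p q ihp ihq =>
    intro h s L hL hs hb
    simp only [SProg.wellFormed, Bool.and_eq_true] at hp
    obtain ⟨t₁, s₁, hex₁, hr₁, hb₁, ht₁⟩ := ihp hp.1 h s L hL hs hb
    obtain ⟨t₂, s₂, hex₂, hr₂, hb₂, ht₂⟩ := ihq hp.2 _ s₁ _ (by omega) hr₁ hb₁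
    refine ⟨_, s₂, .seq hex₁ hex₂, hr₂, ?_, ?_⟩
    · convert hb₂ using 1; simp [SProg.growth]; ring
    · simp only [SProg.growth, SProg.time, Polynomial.eval_add]
      have e : L + (p.growth.eval N + q.growth.eval N) * D =
        L + p.growth.eval N * D + q.growth.eval N * D := by ring
      rw [e, add_mul]
      exact add_le_add (ht₁.trans (Nat.mul_le_mul_left _ (Nat.le_add_right _ _))) ht₂
  | ite e p q ihp ihq =>
    intro h s L hL hs hb
    simp only [SProg.wellFormed, Bool.and_eq_true] at hp
    have c1 := e.compile.cost_le hL hb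
    have c2 := e.compile.len_eval_le hL hb
    simp only [SProg.growth, SProg.time, Polynomial.eval_add, Polynomial.eval_natCast, Nat.cast_id]
    set gp := p.growth.eval N
    set gq := q.growth.eval N
    have l0 : L ≤ L + (gp + gq) * D := Nat.le_add_right _ _
    have l1 : L + gp * D ≤ L + (gp + gq) * D :=
      Nat.add_le_add_left (Nat.mul_le_mul_right _ (Nat.le_add_right _ _)) _
    have l2 : L + gq * D ≤ L + (gp + gq) * D :=
      Nat.add_le_add_left (Nat.mul_le_mul_right _ (Nat.le_add_left _ _)) _
    have c3 := c1.trans (Nat.mul_le_mul_left _ l0)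
    have c4 := c2.trans (Nat.mul_le_mul_left _ l0)
    by_cases hev : e.eval E h = 0
    · obtain ⟨t, s', hex, hr, hb', ht⟩ := ihq hp.2 h s L hL hs hb
      refine ⟨_, s', .ite_false (by rw [hs.eval_compile hE, hev]) hex, ?_, hb'.mono l2, ?_⟩
      · simpa [SProg.run, hev] using hr
      · have := ht.trans (Nat.mul_le_mul_left _ l2)
        simp only [add_mul] at *
        omega
    · obtain ⟨t, s', hex, hr, hb', ht⟩ := ihp hp.1 h s L hL hs hb
      refine ⟨_, s', .ite_true (by rwa [hs.eval_compile hE]) hex, ?_, hb'.mono l1, ?_⟩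
      · simpa [SProg.run, hev] using hr
      · have := ht.trans (Nat.mul_le_mul_left _ l1)
        simp only [add_mul] at *
        omega
  | upTo x b p ih =>
    intro h s L hL hs hb
    simp only [SProg.wellFormed, Bool.and_eq_true, decide_eq_true_eq] at hp
    have hb0 : (s.setReg (x.idx + 4) 0).Bounded L := hb.setReg (by simpa [len] using hL)
    obtain ⟨t, s', hex, hr, hb', ht⟩ := exec_loop hD x b p hp.1 _ _ (ih hp.2) le_rfl
      (h.setVar x 0) (s.setReg (x.idx + 4) 0) L hL (hs.setVar x 0) hb0 (by simp)
    simp only [SProg.growth, SProg.time, Polynomial.eval_add, Polynomial.eval_natCast, Nat.cast_id,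
      Polynomial.eval_mul, Polynomial.eval_X, Polynomial.eval_one]
    set g := p.growth.eval N
    have l : L + b.val E * (g + 1) * D ≤ L + (1 + N * (g + 1)) * D := by
      refine Nat.add_le_add_left (Nat.mul_le_mul_right _ ?_) _
      exact (Nat.mul_le_mul_right _ (hn b)).trans (Nat.le_add_left _ _)
    refine ⟨_, s', .seq (.assign _ (.lit 0) s) hex, hr, hb'.mono l, ?_⟩
    have ht' := ht.trans (Nat.mul_le_mul_left _ l)
    refine (Nat.add_le_add_left (ht'.trans (Nat.mul_le_mul_right _ (Nat.add_le_add_left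
      (Nat.mul_le_mul_right _ (hn b)) _))) _).trans ?_
    set M := L + (1 + N * (g + 1)) * D with hM
    have h0 : len 0 = 1 := by simp [len]
    have hM1 : 1 ≤ M := by omega
    have c : len (x.idx + 4) ≤ len (x.idx + 4) * M := Nat.le_mul_of_pos_right _ hM1
    simp only [Expr.cost, Expr.eval, h0]
    rw [add_assoc (len (x.idx + 4) + 2), add_mul (len (x.idx + 4) + 2), add_mul _ 2 M]
    refine add_le_add (by omega) le_rfl

end StarCFD

/-! ### Greedy choice of a cheapest set of items that can be matched to players -/

namespace StarCFD

open Classical in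
/-- Items of `S` that are wanted only by players in `D`. -/
noncomputable def captured (P : ℕ → ℕ → Prop) (D S : Finset ℕ) : Finset ℕ :=
  S.filter fun w => ∀ j, P j w → j ∈ D

theorem mem_captured {P : ℕ → ℕ → Prop} {D S : Finset ℕ} {w : ℕ} :
    w ∈ captured P D S ↔ w ∈ S ∧ ∀ j, P j w → j ∈ D := by
  simp [captured]

theorem captured_mono {P : ℕ → ℕ → Prop} {D D' S S' : Finset ℕ} (hD : D ⊆ D') (hS : S ⊆ S') :
    captured P D S ⊆ captured P D' S' := fun w hw => by
  rw [mem_captured] at hw ⊢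
  exact ⟨hS hw.1, fun j hj => hD (hw.2 j hj)⟩

/-- Hall's condition for the set `S` of items. -/
def HallCondition (P : ℕ → ℕ → Prop) (S : Finset ℕ) : Prop :=
  ∀ D : Finset ℕ, (captured P D S).card ≤ D.card

/-- The players `i < n` hold exactly the items of `S`: player `i` holds the item `w` if
`holds i = w + 1`, and no item if `holds i = 0`. -/
structure IsMatching (n : ℕ) (P : ℕ → ℕ → Prop) (holds : ℕ → ℕ) (S : Finset ℕ) : Prop where
  wants : ∀ i < n, ∀ w, holds i = w + 1 → P i w
  inj : ∀ i < n, ∀ j < n, holds i ≠ 0 → holds i = holds j → i = j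
  mem_iff : ∀ w, w ∈ S ↔ ∃ i < n, holds i = w + 1

theorem IsMatching.congr {n : ℕ} {P : ℕ → ℕ → Prop} {f g : ℕ → ℕ} {S : Finset ℕ}
    (h : IsMatching n P f S) (hfg : ∀ i < n, g i = f i) : IsMatching n P g S where
  wants i hi w hw := h.wants i hi w (hfg i hi ▸ hw)
  inj i hi j hj := by rw [hfg i hi, hfg j hj]; exact h.inj i hi j hj
  mem_iff w := by
    rw [h.mem_iff]
    exact exists_congr fun i => and_congr_right fun hi => by rw [hfg i hi]

/-- Sending each captured item to its holder is injective, and the holder wants the item and so lies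
in `D`. -/
theorem IsMatching.hallCondition {n : ℕ} {P : ℕ → ℕ → Prop} {holds : ℕ → ℕ} {S : Finset ℕ}
    (h : IsMatching n P holds S) : HallCondition P S := by
  intro D
  have hex : ∀ w ∈ S, ∃ i < n, holds i = w + 1 := fun w hw => (h.mem_iff w).1 hw
  choose! f hfn hf using hex
  refine Finset.card_le_card_of_injOn f ?_ ?_
  · intro w hw
    obtain ⟨hw, hD⟩ := mem_captured.1 hw
    exact hD _ (h.wants _ (hfn w hw) w (hf w hw))
  · intro w hw w' hw' heq
    have h₁ := hf w (mem_captured.1 hw).1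
    have h₂ := hf w' (mem_captured.1 hw').1
    rw [heq] at h₁
    omega

/-! ### Inserting an item into a matching by pushing -/

/-- Intermediate situation when an item is inserted into a matching: the items of `T` are held by
the players, except for the item `cur - 1` if `cur ≠ 0`. The heights of the players control the
choice of the next player. -/
structure Insertion (n : ℕ) (P : ℕ → ℕ → Prop) (holds height : ℕ → ℕ) (cur : ℕ)
    (T : Finset ℕ) : Prop where
  wants : ∀ i < n, ∀ w, holds i = w + 1 → P i w
  inj : ∀ i < n, ∀ j < n, holds i ≠ 0 → holds i = holds j → i = j
  mem_iff : ∀ w, w ∈ T ↔ cur = w + 1 ∨ ∃ i < n, holds i = w + 1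
  fresh : cur ≠ 0 → ∀ i < n, holds i ≠ cur
  height_eq_zero : ∀ i < n, holds i = 0 → height i = 0
  height_le_succ : ∀ i < n, ∀ w, holds i = w + 1 → ∀ j, P j w → height i ≤ height j + 1
  height_le : ∀ i < n, height i ≤ n

namespace Insertion

variable {n : ℕ} {P : ℕ → ℕ → Prop} {holds height : ℕ → ℕ} {cur : ℕ} {S T : Finset ℕ}

theorem start (h : IsMatching n P holds S) {v : ℕ} (hv : v ∉ S) (h0 : ∀ i < n, height i = 0) :
    Insertion n P holds height (v + 1) (insert v S) where
  wants := h.wants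
  inj := h.inj
  mem_iff w := by
    rw [Finset.mem_insert, h.mem_iff]
    exact or_congr ⟨fun h => by omega, fun h => by omega⟩ Iff.rfl
  fresh _ i hi heq := hv ((h.mem_iff v).2 ⟨i, hi, heq⟩)
  height_eq_zero i hi _ := h0 i hi
  height_le_succ i hi w _ j _ := by rw [h0 i hi]; omega
  height_le i hi := by rw [h0 i hi]; omega

theorem isMatching (h : Insertion n P holds height 0 T) : IsMatching n P holds T where
  wants := h.wants
  inj := h.inj
  mem_iff w := by rw [h.mem_iff]; simp

/-- One push. Heights never decrease, so the inequality for the items held elsewhere survives; for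
the item now held by `b` it is the minimality of `b`. The displaced item `holds b` becomes current,
and the insertion is complete if this is 0. -/
theorem step {w b : ℕ} (h : Insertion n P holds height (w + 1) T) (hP : ∀ j v, P j v → j < n)
    (hb : P b w) (hlt : height b < n) (hmin : ∀ j, P j w → height b ≤ height j) :
    Insertion n P (Function.update holds b (w + 1)) (Function.update height b (height b + 1))
      (holds b) T := by
  have hbn := hP b w hb
  have hfresh := h.fresh (by omega)
  have hh : ∀ j, height j ≤ Function.update height b (height b + 1) j := by
    intro j
    by_cases hj : j = b
    · subst hj; simp
    · simp [hj]
  refine ⟨?_, ?_, ?_, ?_, ?_, ?_, ?_⟩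
  · intro i hi v hv
    by_cases hib : i = b
    · subst hib
      simp only [Function.update_self] at hv
      obtain rfl : v = w := by omega
      exact hb
    · rw [Function.update_of_ne hib] at hv
      exact h.wants i hi v hv
  · intro i hi j hj h0 heq
    by_cases hib : i = b <;> by_cases hjb : j = b
    · rw [hib, hjb]
    · subst hib
      rw [Function.update_self, Function.update_of_ne hjb] at heq
      exact absurd heq.symm (hfresh j hj)
    · subst hjb
      rw [Function.update_self, Function.update_of_ne hib] at heq
      exact absurd heq (hfresh i hi)
    · rw [Function.update_of_ne hib] at h0 heq
      rw [Function.update_of_ne hjb] at heq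
      exact h.inj i hi j hj h0 heq
  · intro v
    rw [h.mem_iff]
    constructor
    · rintro (hv | ⟨i, hi, hv⟩)
      · exact Or.inr ⟨b, hbn, by simpa using hv⟩
      · by_cases hib : i = b
        · subst hib; exact Or.inl hv
        · exact Or.inr ⟨i, hi, by rwa [Function.update_of_ne hib]⟩
    · rintro (hv | ⟨i, hi, hv⟩)
      · exact Or.inr ⟨b, hbn, hv⟩
      · by_cases hib : i = b
        · subst hib; exact Or.inl (by simpa using hv)
        · exact Or.inr ⟨i, hi, by rwa [Function.update_of_ne hib] at hv⟩
  · intro h0 i hi heq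
    by_cases hib : i = b
    · subst hib
      rw [Function.update_self] at heq
      exact hfresh i hi heq.symm
    · rw [Function.update_of_ne hib] at heq
      exact hib (h.inj i hi b hbn (heq ▸ h0) heq)
  · intro i hi h0
    by_cases hib : i = b
    · subst hib; simp at h0
    · rw [Function.update_of_ne hib] at h0 ⊢
      exact h.height_eq_zero i hi h0
  · intro i hi v hv j hj
    refine le_trans ?_ (Nat.succ_le_succ (hh j))
    by_cases hib : i = b
    · subst hib
      rw [Function.update_self] at hv ⊢
      obtain rfl : v = w := by omega
      exact Nat.succ_le_succ (hmin j hj)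
    · rw [Function.update_of_ne hib] at hv ⊢
      exact h.height_le_succ i hi v hv j hj
  · intro i hi
    by_cases hib : i = b
    · subst hib; simpa using hlt
    · rw [Function.update_of_ne hib]; exact h.height_le i hi

/-- If no player can take the current item, Hall's condition fails. -/
theorem exists_card_lt {w : ℕ} (h : Insertion n P holds height (w + 1) T)
    (hP : ∀ j v, P j v → j < n) (hstuck : ∀ j, P j w → n ≤ height j) :
    ∃ D : Finset ℕ, D.card < (captured P D T).card := by
  have hwT : w ∈ T := (h.mem_iff w).2 (Or.inl rfl)
  by_cases hno : ∀ j, ¬ P j w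
  · refine ⟨∅, Finset.card_pos.2 ⟨w, mem_captured.2 ⟨hwT, fun j hj => absurd hj (hno j)⟩⟩⟩
  push Not at hno
  obtain ⟨j₀, hj₀⟩ := hno
  have hj₀n := hP _ _ hj₀
  -- Player `j₀` has height at least `n`, so the other `n - 1` players cannot realize all the
  -- heights `0, …, n - 1`; some height `g` is missing.
  obtain ⟨g, hg, hgap⟩ : ∃ g ∈ Finset.range n, g ∉ ((Finset.range n).erase j₀).image height := by
    refine Finset.exists_mem_notMem_of_card_lt_card ?_
    refine Finset.card_image_le.trans_lt ?_
    rw [Finset.card_erase_of_mem (Finset.mem_range.2 hj₀n), Finset.card_range]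
    omega
  rw [Finset.mem_range] at hg
  have hgap' : ∀ j < n, height j ≠ g := by
    intro j hj heq
    by_cases hjj : j = j₀
    · subst hjj; have := hstuck j hj₀; omega
    · exact hgap (Finset.mem_image.2 ⟨j, by simp [hjj, hj], heq⟩)
  -- The players above the gap violate Hall's condition. Each of them holds an item, and whoever
  -- wants that item is at most one level lower, hence not below the gap. So all these items are
  -- captured, and the current item is captured in addition.
  set D := (Finset.range n).filter fun i => g < height i with hD
  have hDmem : ∀ i, i ∈ D ↔ i < n ∧ g < height i := by simp [hD]
  refine ⟨D, ?_⟩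
  have hholds : ∀ i ∈ D, holds i = (holds i - 1) + 1 := by
    intro i hi
    obtain ⟨hin, hgi⟩ := (hDmem i).1 hi
    have : holds i ≠ 0 := fun h0 => by have := h.height_eq_zero i hin h0; omega
    omega
  have himg : D.image (fun i => holds i - 1) ⊆ (captured P D T).erase w := by
    intro v hv
    obtain ⟨i, hi, rfl⟩ := Finset.mem_image.1 hv
    obtain ⟨hin, hgi⟩ := (hDmem i).1 hi
    have hh := hholds i hi
    refine Finset.mem_erase.2 ⟨?_, mem_captured.2 ⟨(h.mem_iff _).2 (Or.inr ⟨i, hin, hh⟩), ?_⟩⟩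
    · intro heq
      exact h.fresh (by omega) i hin (by omega)
    · intro j hj
      have hjn := hP _ _ hj
      have h₁ := h.height_le_succ i hin _ hh j hj
      have h₂ := hgap' j hjn
      exact (hDmem j).2 ⟨hjn, by omega⟩
  have hcard : (D.image (fun i => holds i - 1)).card = D.card := by
    refine Finset.card_image_of_injOn ?_
    intro i hi j hj heq
    have h₁ := hholds i hi
    have h₂ := hholds j hj
    simp only at heq
    exact h.inj i ((hDmem i).1 hi).1 j ((hDmem j).1 hj).1 (by omega) (by omega)
  have hw : w ∈ captured P D T :=
    mem_captured.2 ⟨hwT, fun j hj => (hDmem j).2 ⟨hP _ _ hj, hg.trans_le (hstuck j hj)⟩⟩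
  have := Finset.card_le_card himg
  rw [hcard, Finset.card_erase_of_mem hw] at this
  have hpos : 0 < (captured P D T).card := Finset.card_pos.2 ⟨w, hw⟩
  omega

end Insertion

/-! ### Optimality of the greedy choice -/

/-- After processing the items of `X` in the order of their costs the greedy algorithm has chosen
the set `S`. For each cost `θ` there is a set `D` of players which shows that no rejected item of
cost at most `θ` can be added to the chosen items of cost at most `θ`. -/
structure IsGreedy (P : ℕ → ℕ → Prop) (cost : ℕ → ℚ) (X S : Finset ℕ) : Prop where
  subset : S ⊆ X
  cert : ∀ θ : ℚ, ∃ D : Finset ℕ,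
    (∀ w ∈ X, w ∉ S → cost w ≤ θ → ∀ j, P j w → j ∈ D) ∧
      D.card ≤ (captured P D (S.filter fun w => cost w ≤ θ)).card

namespace IsGreedy

variable {P : ℕ → ℕ → Prop} {cost : ℕ → ℚ} {X S : Finset ℕ}

theorem empty : IsGreedy P cost ∅ ∅ := ⟨subset_rfl, fun _ => ⟨∅, by simp, by simp⟩⟩

/-- The old certificates remain valid: no new item is rejected, and the captured set can only grow.
-/
theorem accept (h : IsGreedy P cost X S) (v : ℕ) :
    IsGreedy P cost (insert v X) (insert v S) := by
  refine ⟨Finset.insert_subset_insert v h.subset, fun θ => ?_⟩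
  obtain ⟨D, h₁, h₂⟩ := h.cert θ
  refine ⟨D, fun w hw hwS hθ => ?_, h₂.trans (Finset.card_le_card (captured_mono subset_rfl ?_))⟩
  · simp only [Finset.mem_insert, not_or] at hw hwS
    exact h₁ w (hw.resolve_left hwS.1) hwS.2 hθ
  · exact Finset.filter_subset_filter _ (Finset.subset_insert v S)

/-- For thresholds below the cost of `v` nothing changes. For the others all of `S` lies below the
threshold, and the old tight set is united with the one that blocks `v`. -/
theorem reject (h : IsGreedy P cost X S) (hS : HallCondition P S) {v : ℕ}
    (hle : ∀ w ∈ X, cost w ≤ cost v)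
    (hv : ∃ D : Finset ℕ, D.card < (captured P D (insert v S)).card) :
    IsGreedy P cost (insert v X) S := by
  refine ⟨h.subset.trans (Finset.subset_insert v X), fun θ => ?_⟩
  obtain ⟨D, h₁, h₂⟩ := h.cert θ
  by_cases hθ : cost v ≤ θ
  · obtain ⟨D', hD'⟩ := hv
    have hSθ : S.filter (fun w => cost w ≤ θ) = S :=
      Finset.filter_true_of_mem fun w hw => (hle w (h.subset hw)).trans hθ
    rw [hSθ] at h₂ ⊢
    -- Otherwise `D'` would already violate Hall's condition for `S`. Hence all players who want `v`
    -- are in `D'`, and removing `v` leaves `D'` tight for `S`.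
    have hvD : v ∈ captured P D' (insert v S) := by
      by_contra hnot
      refine absurd (hS D') (not_le.2 (hD'.trans_le (Finset.card_le_card fun w hw => ?_)))
      have hwv : w ≠ v := fun h => hnot (h ▸ hw)
      rw [mem_captured] at hw ⊢
      exact ⟨(Finset.mem_insert.1 hw.1).resolve_left hwv, hw.2⟩
    have hcard : D'.card ≤ (captured P D' S).card := by
      have : captured P D' (insert v S) ⊆ insert v (captured P D' S) := by
        intro w hw
        rw [mem_captured, Finset.mem_insert] at hw
        rw [Finset.mem_insert, mem_captured]
        tauto
      have := (Finset.card_le_card this).trans (Finset.card_insert_le _ _)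
      omega
    refine ⟨D ∪ D', fun w hw hwS hwθ j hj => ?_, ?_⟩
    · rcases Finset.mem_insert.1 hw with rfl | hw
      · exact Finset.mem_union_right _ ((mem_captured.1 hvD).2 j hj)
      · exact Finset.mem_union_left _ (h₁ w hw hwS hwθ j hj)
    · have hunion : captured P D S ∪ captured P D' S ⊆ captured P (D ∪ D') S :=
        Finset.union_subset (captured_mono Finset.subset_union_left subset_rfl)
          (captured_mono Finset.subset_union_right subset_rfl)
      have hinter : captured P D S ∩ captured P D' S ⊆ captured P (D ∩ D') S := by
        intro w hw
        simp only [Finset.mem_inter, mem_captured] at hw ⊢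
        exact ⟨hw.1.1, fun j hj => ⟨hw.1.2 j hj, hw.2.2 j hj⟩⟩
      have c₁ := Finset.card_le_card hunion
      have c₂ := (Finset.card_le_card hinter).trans (hS (D ∩ D'))
      have c₃ := Finset.card_union_add_card_inter (captured P D S) (captured P D' S)
      have c₄ := Finset.card_union_add_card_inter D D'
      omega
  · refine ⟨D, fun w hw hwS hwθ => ?_, h₂⟩
    rcases Finset.mem_insert.1 hw with rfl | hw
    · exact absurd hwθ hθ
    · exact h₁ w hw hwS hwθ

/-- Split the items of `M` below `θ` at the certificate `D`. Captured ones number at most `D.card`,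
by Hall's condition, hence no more than those of `S`; an uncaptured one is wanted outside `D`, so it
was not rejected and belongs to `S`. -/
theorem card_filter_le (h : IsGreedy P cost X S) {M : Finset ℕ} (hM : HallCondition P M)
    (hMX : M ⊆ X) (θ : ℚ) :
    (M.filter fun w => cost w ≤ θ).card ≤ (S.filter fun w => cost w ≤ θ).card := by
  obtain ⟨D, h₁, h₂⟩ := h.cert θ
  set Mθ := M.filter fun w => cost w ≤ θ
  set Sθ := S.filter fun w => cost w ≤ θ
  have hsub : Mθ \ captured P D Mθ ⊆ Sθ \ captured P D Sθ := by
    intro w hw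
    simp only [Finset.mem_sdiff, mem_captured, Mθ, Sθ, Finset.mem_filter] at hw ⊢
    obtain ⟨⟨hwM, hwθ⟩, hnot⟩ := hw
    have hD : ¬ ∀ j, P j w → j ∈ D := fun hD => hnot ⟨⟨hwM, hwθ⟩, hD⟩
    refine ⟨⟨?_, hwθ⟩, fun h => hD h.2⟩
    by_contra hwS
    exact hD (h₁ w (hMX hwM) hwS hwθ)
  have c₁ := Finset.card_le_card hsub
  have hcap : ∀ U : Finset ℕ, captured P D U ⊆ U := fun U w hw => (mem_captured.1 hw).1
  have c₂ := Finset.card_sdiff_add_card_eq_card (hcap Mθ)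
  have c₃ := Finset.card_sdiff_add_card_eq_card (hcap Sθ)
  have c₄ := (Finset.card_le_card
    (captured_mono (P := P) (subset_refl D) (Finset.filter_subset (fun w => cost w ≤ θ) M))).trans
    (hM D)
  change (captured P D Mθ).card ≤ _ at c₄
  omega

end IsGreedy

/-- If at every threshold `S` has at least as many cheap items as `M`, then the sorted costs of `S`
are dominated term by term. The induction removes a most expensive item from both sets. -/
theorem sum_le_sum_of_card_filter_le {cost : ℕ → ℚ} {S M : Finset ℕ} (hcard : S.card = M.card)
    (h : ∀ θ : ℚ, (M.filter fun w => cost w ≤ θ).card ≤ (S.filter fun w => cost w ≤ θ).card) :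
    ∑ w ∈ S, cost w ≤ ∑ w ∈ M, cost w := by
  induction hk : S.card generalizing S M with
  | zero =>
    rw [Finset.card_eq_zero.1 hk, Finset.card_eq_zero.1 (hcard.symm.trans hk)]
  | succ k ih =>
    obtain ⟨x, hx, hxmax⟩ := S.exists_max_image cost (Finset.card_pos.1 (by omega))
    obtain ⟨y, hy, hymax⟩ := M.exists_max_image cost (Finset.card_pos.1 (by omega))
    -- At the threshold `cost y` all of `M` is counted, hence all of `S`.
    have hxy : cost x ≤ cost y := by
      have h₁ := h (cost y)
      rw [Finset.filter_true_of_mem hymax, ← hcard] at h₁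
      have h₂ := Finset.eq_of_subset_of_card_le (Finset.filter_subset _ _) h₁
      rw [← h₂] at hx
      exact (Finset.mem_filter.1 hx).2
    have hSx := Finset.card_erase_of_mem hx
    have hMy := Finset.card_erase_of_mem hy
    have key := ih (S := S.erase x) (M := M.erase y) (by omega) (fun θ => ?_) (by omega)
    · rw [← Finset.add_sum_erase _ _ hx, ← Finset.add_sum_erase _ _ hy]
      exact add_le_add hxy key
    · by_cases hθ : cost x ≤ θ
      · rw [Finset.filter_true_of_mem (s := S.erase x) fun w hw =>
          (hxmax w (Finset.mem_of_mem_erase hw)).trans hθ]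
        exact (Finset.card_le_card (Finset.filter_subset _ _)).trans (by omega)
      · have hx' : x ∉ S.filter fun w => cost w ≤ θ := by simp [hθ]
        have hy' : y ∉ M.filter fun w => cost w ≤ θ := by
          simp only [Finset.mem_filter, not_and]
          exact fun _ h => hθ (hxy.trans h)
        rw [Finset.filter_erase, Finset.filter_erase, Finset.erase_eq_of_notMem hx',
          Finset.erase_eq_of_notMem hy']
        exact h θ

end StarCFD

/-! ### The algorithm -/

namespace StarCFD

open RAM SProg

instance : Coe Var SExpr := ⟨.var⟩
instance (k : ℕ) : OfNat SExpr k := ⟨.lit k⟩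
instance : Add SExpr := ⟨.bin .add⟩
instance : Sub SExpr := ⟨.bin .sub⟩
instance : Mul SExpr := ⟨.bin .mul⟩

section

variable (E : Env) (h : Store)

@[simp] theorem SExpr.eval_bound (b : Bound) : (SExpr.bound b).eval E h = b.val E := rfl

@[simp] theorem SExpr.eval_var (x : Var) : (SExpr.var x).eval E h = h.var x := rfl

@[simp] theorem SExpr.eval_inp (e : SExpr) : (SExpr.inp e).eval E h = E.read (e.eval E h) := rfl

@[simp] theorem SExpr.eval_arr (a : Arr) (e : SExpr) :
    (SExpr.arr a e).eval E h = h.arr a (e.eval E h) := rfl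

@[simp] theorem run_skip : skip.run E h = h := rfl

@[simp] theorem run_set (x : Var) (e : SExpr) : (set x e).run E h = h.setVar x (e.eval E h) := rfl

@[simp] theorem run_store (a : Arr) (i e : SExpr) :
    (store a i e).run E h = h.setArr a (i.eval E h) (e.eval E h) := rfl

@[simp] theorem run_seq (p q : SProg) : (seq p q).run E h = q.run E (p.run E h) := rfl

@[simp] theorem SExpr.eval_ofNat (k : ℕ) : SExpr.eval E h ofNat(k) = k := rfl

@[simp] theorem SExpr.eval_add (e₁ e₂ : SExpr) :
    SExpr.eval E h (e₁ + e₂) = e₁.eval E h + e₂.eval E h := rfl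

@[simp] theorem SExpr.eval_sub (e₁ e₂ : SExpr) :
    SExpr.eval E h (e₁ - e₂) = e₁.eval E h - e₂.eval E h := rfl

@[simp] theorem SExpr.eval_mul (e₁ e₂ : SExpr) :
    SExpr.eval E h (e₁ * e₂) = e₁.eval E h * e₂.eval E h := rfl

@[simp] theorem Bound.val_players : Bound.players.val E = E.n := rfl

@[simp] theorem Bound.val_items : Bound.items.val E = E.m := rfl

/-- Numerator of the utility of item `v` for player `i`. -/
def Env.num (E : Env) (i v : ℕ) : ℕ := E.read (2 + E.m * E.m + 2 * (i * E.m + v))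

/-- Denominator of the utility of item `v` for player `i`. -/
def Env.den (E : Env) (i v : ℕ) : ℕ := E.read (3 + E.m * E.m + 2 * (i * E.m + v))

abbrev playersE : SExpr := .bound .players

abbrev itemsE : SExpr := .bound .items

def numE (i v : SExpr) : SExpr := .inp (2 + itemsE * itemsE + 2 * (i * itemsE + v))

def denE (i v : SExpr) : SExpr := .inp (3 + itemsE * itemsE + 2 * (i * itemsE + v))

@[simp] theorem eval_numE (i v : SExpr) :
    (numE i v).eval E h = E.num (i.eval E h) (v.eval E h) := rfl

@[simp] theorem eval_denE (i v : SExpr) :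
    (denE i v).eval E h = E.den (i.eval E h) (v.eval E h) := rfl

/-- Row `0` of the adjacency matrix determines the center of a star. -/
def findCenter : SProg :=
  .seq (.set .center 0) <| .seq (.set .degree 0) <|
  .seq (.upTo .item .items <|
    .seq (.set .center (Var.center + Var.item * .inp (2 + Var.item)))
      (.set .degree (Var.degree + .inp (2 + Var.item)))) <|
  .ite (Var.degree - 1) (.set .center 0) .skip

/-- Find an unprocessed item that is cheapest for the owner of the center. -/
def select : SProg :=
  .seq (.set .best 0) <| .upTo .item .items <|
  .ite (.arr .done Var.item) .skip <|
  .ite Var.best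
    -- Cross-multiplied comparison: the truncated difference is nonzero iff the item is strictly
    -- cheaper than the best one so far. Items are stored shifted by one, since 0 means that there
    -- is none.
    (.ite (numE Var.owner (Var.best - 1) * denE Var.owner Var.item -
        numE Var.owner Var.item * denE Var.owner (Var.best - 1))
      (.set .best (Var.item + 1)) .skip)
    (.set .best (Var.item + 1))

/-- Find a player of minimal height who wants the current item. -/
def findPartner : SProg :=
  .seq (.set .level playersE) <| .upTo .player .players <|
  .ite (Var.level - .arr .height Var.player)
    (.ite ((Var.player - Var.owner) + (Var.owner - Var.player))
      (.ite (playersE * numE Var.player (Var.current - 1) + 1 - denE Var.player (Var.current - 1))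
        (.seq (.set .level (.arr .height Var.player)) (.set .partner Var.player)) .skip) .skip)
    .skip

/-- Hand the current item to such a player; the item this player held becomes current. -/
def push : SProg :=
  .ite Var.current
    (.seq findPartner <|
      .ite (playersE - Var.level)
        (.seq (.set .displaced (.arr .holding Var.partner)) <|
          .seq (.store .holding Var.partner Var.current) <|
          .seq (.set .current Var.displaced)
            (.store .height Var.partner (.arr .height Var.partner + 1))) .skip) .skip

/-- The n² rounds match the largest possible sum of heights; after the insertion is finished or
blocked, further pushes do not change the matching. -/
def pushAll : SProg := .upTo .outer .players (.upTo .inner .players push)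

/-- The backup is needed because a blocked insertion has already rearranged the matching. Heights
start again at 0 for each insertion. -/
def save : SProg :=
  .upTo .player .players <|
    .seq (.store .backup Var.player (.arr .holding Var.player)) (.store .height Var.player 0)

def restore : SProg :=
  .upTo .player .players (.store .holding Var.player (.arr .backup Var.player))

/-- The cost of the chosen items is kept as an unreduced fraction. In each product the second factor
is read from the input, as the length bound requires. -/
def record : SProg :=
  .seq (.set .numer (Var.numer * denE Var.owner (Var.best - 1) +
      Var.denom * numE Var.owner (Var.best - 1))) <|
  .seq (.set .denom (Var.denom * denE Var.owner (Var.best - 1)))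
    (.set .count (Var.count + 1))

/-- Try to add the selected item to the matched items. -/
def process : SProg :=
  .seq (.store .done (Var.best - 1) 1) <| .seq save <| .seq (.set .current Var.best) <|
  .seq pushAll <| .ite Var.current restore record

/-- Marking the center as done keeps it from ever being selected; the cost starts as the fraction
0/1. -/
def reset : SProg :=
  .seq (.upTo .player .players (.store .holding Var.player 0)) <|
  .seq (.upTo .item .items (.store .done Var.item 0)) <|
  .seq (.store .done Var.center 1) <| .seq (.set .numer 0) <| .seq (.set .denom 1)
    (.set .count 0)

/-- The sum of both truncated differences vanishes iff all players but the owner are matched. The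
second test is the inequality "cost at most 1 - 1/n" with denominators cleared. -/
def verdict : SProg :=
  .ite ((Var.count + 1 - playersE) + (playersE - (Var.count + 1))) .skip <|
  .ite (playersE * Var.numer + Var.denom - playersE * Var.denom) .skip (.set .answer 1)

def greedy : SProg := .upTo .round .items (.seq select (.ite Var.best process .skip))

def decideProg : SProg :=
  .seq findCenter <| .seq (.ite playersE (.set .answer 0) (.set .answer 1)) <|
  .upTo .owner .players (.seq reset (.seq greedy verdict))

theorem wellFormed_decideProg : decideProg.wellFormed = true := by decide

end

/-! ### Correctness of the algorithm -/

/-- Player `i` is not the owner `k` of the center and is satisfied by item `w` alone. -/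
def Env.Wants (E : Env) (k i w : ℕ) : Prop := i < E.n ∧ i ≠ k ∧ E.den i w ≤ E.n * E.num i w

/-- The utility of item `w` for player `k`. -/
def Env.cost (E : Env) (k w : ℕ) : ℚ := E.num k w / E.den k w

/-- The other players can be satisfied by single leaves such that enough remains for player `k`. -/
def Env.Feasible (E : Env) (c k : ℕ) : Prop :=
  ∃ (f : ℕ → ℕ) (S : Finset ℕ), IsMatching E.n (E.Wants k) f S ∧ S ⊆ (Finset.range E.m).erase c ∧
    S.card + 1 = E.n ∧ ∑ w ∈ S, E.cost k w ≤ 1 - 1 / E.n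

theorem run_select (E : Env) (h : Store) (hden : ∀ w < E.m, 0 < E.den (h.var .owner) w) :
    ((select.run E h).var .best = 0 ∧ ∀ w < E.m, h.arr .done w ≠ 0) ∨
    ∃ v < E.m, (select.run E h).var .best = v + 1 ∧ h.arr .done v = 0 ∧
      ∀ w < E.m, h.arr .done w = 0 → E.cost (h.var .owner) v ≤ E.cost (h.var .owner) w := by
  rw [select, run]
  have hlt : ∀ v < E.m, ∀ w < E.m, E.cost (h.var .owner) v ≤ E.cost (h.var .owner) w ↔
      E.num (h.var .owner) v * E.den (h.var .owner) w ≤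
        E.num (h.var .owner) w * E.den (h.var .owner) v := by
    intro v hv w hw
    have h₁ : (0 : ℚ) < E.den (h.var .owner) v := by exact_mod_cast hden v hv
    have h₂ : (0 : ℚ) < E.den (h.var .owner) w := by exact_mod_cast hden w hw
    rw [Env.cost, Env.cost, div_le_div_iff₀ h₁ h₂]
    exact_mod_cast Iff.rfl
  refine run_upTo_induction E (b := .items) (by decide) (fun j h' =>
    (h'.var .best = 0 ∧ ∀ w < j, h.arr .done w ≠ 0) ∨
    ∃ v < E.m, h'.var .best = v + 1 ∧ h.arr .done v = 0 ∧
      ∀ w < j, h.arr .done w = 0 → E.cost (h.var .owner) v ≤ E.cost (h.var .owner) w)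
    _ (by simp [run]) ?_
  intro j h' hj hitem hvar harr hinv
  have howner : h'.var .owner = h.var .owner := by
    rw [hvar _ (by decide)]; simp [run]
  have hdone : h'.arr .done = h.arr .done := by
    rw [harr _ (by decide)]; simp [run]
  simp only [Bound.val_items] at hj
  by_cases hd : h.arr .done j = 0
  · rw [run_ite_neg (by simpa [hitem, hdone] using hd)]
    rcases hinv with ⟨hb, hall⟩ | ⟨v, hv, hb, hdv, hall⟩
    · right
      rw [run_ite_neg (by simpa using hb)]
      refine ⟨j, hj, by simp [hitem], hd, fun w hw hdw => ?_⟩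
      rcases Nat.lt_succ_iff_lt_or_eq.1 hw with hw | rfl
      · exact absurd hdw (hall w hw)
      · exact le_rfl
    · right
      rw [run_ite_pos (by simp [hb])]
      by_cases hcmp : E.num (h.var .owner) v * E.den (h.var .owner) j ≤
          E.num (h.var .owner) j * E.den (h.var .owner) v
      · rw [run_ite_neg (by simpa [hb, hitem, howner, Nat.sub_eq_zero_iff_le] using hcmp)]
        refine ⟨v, hv, by simp [hb], hdv, fun w hw hdw => ?_⟩
        rcases Nat.lt_succ_iff_lt_or_eq.1 hw with hw | rfl
        · exact hall w hw hdw
        · rwa [hlt v hv w hj]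
      · rw [run_ite_pos (by simpa [hb, hitem, howner, Nat.sub_eq_zero_iff_le] using hcmp)]
        have hjv : E.cost (h.var .owner) j ≤ E.cost (h.var .owner) v := by
          rw [hlt j hj v hv]; omega
        refine ⟨j, hj, by simp [hitem], hd, fun w hw hdw => ?_⟩
        rcases Nat.lt_succ_iff_lt_or_eq.1 hw with hw | rfl
        · exact hjv.trans (hall w hw hdw)
        · exact le_rfl
  · rw [run_ite_pos (by simpa [hitem, hdone] using hd), run_skip]
    rcases hinv with ⟨hb, hall⟩ | ⟨v, hv, hb, hdv, hall⟩
    · refine Or.inl ⟨by simp [hb], fun w hw => ?_⟩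
      rcases Nat.lt_succ_iff_lt_or_eq.1 hw with hw | rfl
      exacts [hall w hw, hd]
    · refine Or.inr ⟨v, hv, by simp [hb], hdv, fun w hw hdw => ?_⟩
      rcases Nat.lt_succ_iff_lt_or_eq.1 hw with hw | rfl
      exacts [hall w hw hdw, absurd hdw hd]

theorem run_findPartner (E : Env) (h : Store) {w : ℕ} (hw : h.var .current = w + 1) :
    ((findPartner.run E h).var .level = E.n ∧
      ∀ i, E.Wants (h.var .owner) i w → E.n ≤ h.arr .height i) ∨
    ((findPartner.run E h).var .level < E.n ∧
      E.Wants (h.var .owner) ((findPartner.run E h).var .partner) w ∧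
      h.arr .height ((findPartner.run E h).var .partner) < E.n ∧
      ∀ i, E.Wants (h.var .owner) i w →
        h.arr .height ((findPartner.run E h).var .partner) ≤ h.arr .height i) := by
  -- The loop invariant has to record also that `level` is the height of the chosen partner.
  suffices H : ((findPartner.run E h).var .level = E.n ∧
      ∀ i < E.n, E.Wants (h.var .owner) i w → E.n ≤ h.arr .height i) ∨
    ((findPartner.run E h).var .level < E.n ∧
      h.arr .height ((findPartner.run E h).var .partner) = (findPartner.run E h).var .level ∧
      E.Wants (h.var .owner) ((findPartner.run E h).var .partner) w ∧
      ∀ i < E.n, E.Wants (h.var .owner) i w →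
        (findPartner.run E h).var .level ≤ h.arr .height i) by
    rcases H with ⟨h₁, h₂⟩ | ⟨h₁, h₂, h₃, h₄⟩
    · exact Or.inl ⟨h₁, fun i hi => h₂ i hi.1 hi⟩
    · rw [← h₂] at h₁ h₄
      exact Or.inr ⟨h₂ ▸ h₁, h₃, h₁, fun i hi => h₄ i hi.1 hi⟩
  rw [findPartner, run]
  refine run_upTo_induction E (b := .players) (by decide) (fun j h' =>
    (h'.var .level = E.n ∧ ∀ i < j, E.Wants (h.var .owner) i w → E.n ≤ h.arr .height i) ∨
    (h'.var .level < E.n ∧ h.arr .height (h'.var .partner) = h'.var .level ∧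
      E.Wants (h.var .owner) (h'.var .partner) w ∧
      ∀ i < j, E.Wants (h.var .owner) i w → h'.var .level ≤ h.arr .height i))
    _ (by simp [run]) ?_
  intro j h' hj hplayer hvar harr hinv
  have howner : h'.var .owner = h.var .owner := by
    rw [hvar _ (by decide)]; simp [run]
  have hcur : h'.var .current = w + 1 := by
    rw [hvar _ (by decide)]; simp [run, hw]
  have hheight : h'.arr .height = h.arr .height := by
    rw [harr _ (by decide)]; simp [run]
  simp only [Bound.val_players] at hj
  have hlev : h'.var .level ≤ E.n := by rcases hinv with h | h <;> omega
  by_cases hgood : h.arr .height j < h'.var .level ∧ E.Wants (h.var .owner) j w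
  · obtain ⟨hlt, hwants⟩ := hgood
    obtain ⟨-, hne, hle⟩ := id hwants
    -- The three tests in truncated arithmetic express that the height is below `level`, that the
    -- player is not the owner, and that the item is worth at least 1/n.
    have e₁ : h'.var .level - h.arr .height j ≠ 0 := by omega
    have e₂ : j - h.var .owner + (h.var .owner - j) ≠ 0 := by omega
    have e₃ : E.n * E.num j w + 1 - E.den j w ≠ 0 := by omega
    right
    rw [run_ite_pos (by simpa only [SExpr.eval_sub, SExpr.eval_var, SExpr.eval_arr, hplayer,
      hheight] using e₁), run_ite_pos (by simpa only [SExpr.eval_sub, SExpr.eval_add,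
      SExpr.eval_var, howner, hplayer] using e₂), run_ite_pos (by simpa only [SExpr.eval_sub,
      SExpr.eval_add, SExpr.eval_mul, eval_numE, eval_denE, SExpr.eval_bound, Bound.val_players,
      SExpr.eval_var, SExpr.eval_ofNat, hcur, hplayer, Nat.add_sub_cancel] using e₃)]
    simp only [run_seq, run_set, SExpr.eval_arr, SExpr.eval_var, hplayer, hheight]
    refine ⟨by simp; omega, by simp [hplayer], by simpa [hplayer] using hwants, fun i hi hi' => ?_⟩
    rcases Nat.lt_succ_iff_lt_or_eq.1 hi with hi | rfl
    · rcases hinv with ⟨hl, hall⟩ | ⟨_, _, _, hall⟩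
      · have := hall i hi hi'; simp; omega
      · have := hall i hi hi'; simp; omega
    · simp
  · have hsame : (SProg.run E (.ite (Var.level - .arr .height Var.player)
        (.ite ((Var.player - Var.owner) + (Var.owner - Var.player))
          (.ite (playersE * numE Var.player (Var.current - 1) + 1 -
              denE Var.player (Var.current - 1))
            (.seq (.set .level (.arr .height Var.player)) (.set .partner Var.player)) .skip) .skip)
        .skip) h') = h' := by
      by_cases e₁ : h'.var .level ≤ h.arr .height j
      · rw [run_ite_neg (by simpa [hplayer, hheight, Nat.sub_eq_zero_iff_le] using e₁), run_skip]
      rw [run_ite_pos (by simpa [hplayer, hheight, Nat.sub_eq_zero_iff_le] using e₁)]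
      by_cases e₂ : j = h.var .owner
      · rw [run_ite_neg (by simp [hplayer, howner, e₂]), run_skip]
      have e₄ : j - h.var .owner + (h.var .owner - j) ≠ 0 := by omega
      rw [run_ite_pos (by simpa only [SExpr.eval_sub, SExpr.eval_add, SExpr.eval_var, howner,
        hplayer] using e₄)]
      refine (run_ite_neg ?_ _ _).trans (run_skip E h')
      have e₃ : ¬ E.den j w ≤ E.n * E.num j w := fun hle => hgood ⟨by omega, hj, e₂, hle⟩
      simp only [SExpr.eval_sub, SExpr.eval_add, SExpr.eval_mul, eval_numE, eval_denE,
        SExpr.eval_bound, Bound.val_players, SExpr.eval_var, SExpr.eval_ofNat, hcur, hplayer,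
        Nat.add_sub_cancel]
      omega
    rw [hsame]
    have hbad : E.Wants (h.var .owner) j w → h'.var .level ≤ h.arr .height j := fun hw' =>
      not_lt.1 fun hlt => hgood ⟨hlt, hw'⟩
    rcases hinv with ⟨hl, hall⟩ | ⟨h₁, h₂, h₃, hall⟩
    · refine Or.inl ⟨by simpa using hl, fun i hi hi' => ?_⟩
      rcases Nat.lt_succ_iff_lt_or_eq.1 hi with hi | rfl
      exacts [hall i hi hi', hl ▸ hbad hi']
    · refine Or.inr ⟨by simpa using h₁, by simpa using h₂, by simpa using h₃, fun i hi hi' => ?_⟩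
      rw [Store.setVar_var, if_neg (by decide)]
      rcases Nat.lt_succ_iff_lt_or_eq.1 hi with hi | rfl
      exacts [hall i hi hi', hbad hi']

/-! ### Termination of the pushing phase -/

/-- Loop invariant for pushing: after `t` steps the insertion is finished, or blocked, or the sum of
the heights is at least `t`. -/
def PushInv (E : Env) (k : ℕ) (T : Finset ℕ) (t : ℕ) (h : Store) : Prop :=
  h.var .owner = k ∧
  Insertion E.n (E.Wants k) (h.arr .holding) (h.arr .height) (h.var .current) T ∧
  (h.var .current = 0 ∨
    (∃ w, h.var .current = w + 1 ∧ ∀ i, E.Wants k i w → E.n ≤ h.arr .height i) ∨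
    t ≤ ∑ i ∈ Finset.range E.n, h.arr .height i)

theorem PushInv.setVar {E : Env} {k t : ℕ} {T : Finset ℕ} {h : Store} (hh : PushInv E k T t h)
    {x : Var} (hx : x = .inner ∨ x = .outer) (j : ℕ) : PushInv E k T t (h.setVar x j) := by
  rcases hx with rfl | rfl <;> simpa [PushInv] using hh

theorem PushInv.push {E : Env} {k t : ℕ} {T : Finset ℕ} {h : Store} (hh : PushInv E k T t h) :
    PushInv E k T (t + 1) (push.run E h) := by
  obtain ⟨hk, hins, hcase⟩ := hh
  rw [StarCFD.push]
  rcases Nat.eq_zero_or_pos (h.var .current) with hc | hc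
  · rw [run_ite_neg (by simpa using hc), run_skip]
    exact ⟨hk, hins, Or.inl hc⟩
  obtain ⟨w, hw⟩ : ∃ w, h.var .current = w + 1 := ⟨h.var .current - 1, by omega⟩
  rw [run_ite_pos (by simpa using hc.ne'), run_seq]
  have spec := run_findPartner E h hw
  have a₁ : (findPartner.run E h).arr .holding = h.arr .holding :=
    run_arr_of_notMem E (by decide) h
  have a₂ : (findPartner.run E h).arr .height = h.arr .height := run_arr_of_notMem E (by decide) h
  have a₃ : (findPartner.run E h).var .owner = h.var .owner := run_var_of_notMem E (by decide) h
  have a₄ : (findPartner.run E h).var .current = h.var .current :=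
    run_var_of_notMem E (by decide) h
  rw [hk] at spec
  rcases spec with ⟨hl, hall⟩ | ⟨hl, hwants, hlt, hmin⟩
  · rw [run_ite_neg (by simp [hl]), run_skip]
    refine ⟨a₃.trans hk, by rwa [a₁, a₂, a₄], Or.inr (Or.inl ⟨w, a₄.trans hw, by rwa [a₂]⟩)⟩
  · rw [run_ite_pos (by simpa [Nat.sub_eq_zero_iff_le] using hl)]
    rw [hw] at hins
    have hnext := hins.step (fun j v hj => hj.1) hwants hlt hmin
    refine ⟨by simp [a₃, hk], by simpa [a₁, a₂, a₄, hw] using hnext, Or.inr (Or.inr ?_)⟩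
    -- A partner was found, so the insertion was neither finished nor blocked before; only the third
    -- alternative of the invariant remains, and this push adds 1 to the sum.
    have hsum : t ≤ ∑ i ∈ Finset.range E.n, h.arr .height i := by
      rcases hcase with h₀ | ⟨v, hv, hall⟩ | h₀
      · omega
      · obtain rfl : v = w := by omega
        have := hall _ hwants
        omega
      · exact h₀
    simp only [run_seq, run_set, run_store, SExpr.eval_var, SExpr.eval_arr, SExpr.eval_add,
      SExpr.eval_ofNat, Store.setArr_arr, Store.setVar_arr, a₁, a₂, Store.setVar_var,
      Store.setArr_var, reduceCtorEq, if_true, if_false]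
    have hmem := Finset.mem_range.2 hwants.1
    rw [Finset.sum_update_of_mem hmem]
    rw [Finset.sum_eq_add_sum_sdiff_singleton_of_mem hmem] at hsum
    omega

theorem run_pushAll (E : Env) (h : Store) {k : ℕ} {T : Finset ℕ} (hk : h.var .owner = k)
    (hins : Insertion E.n (E.Wants k) (h.arr .holding) (h.arr .height) (h.var .current) T) :
    ((pushAll.run E h).var .current = 0 ∧
      IsMatching E.n (E.Wants k) ((pushAll.run E h).arr .holding) T) ∨
    ((pushAll.run E h).var .current ≠ 0 ∧
      ∃ D : Finset ℕ, D.card < (captured (E.Wants k) D T).card) := by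
  have key : PushInv E k T (E.n * E.n) (pushAll.run E h) := by
    refine run_upTo_induction E (b := .players) (by decide)
      (fun j h' => PushInv E k T (j * E.n) h') h
      (PushInv.setVar ⟨hk, hins, Or.inr (Or.inr (by simp))⟩ (by simp) 0) ?_
    intro j h' _ _ _ _ hinv
    refine PushInv.setVar ?_ (by simp) _
    have := run_upTo_induction E (x := .inner) (b := .players) (p := push) (by decide)
      (fun i h' => PushInv E k T (j * E.n + i) h') h' (by simpa using hinv.setVar (by simp) 0)
      (fun i h'' _ _ _ _ hinv' => PushInv.setVar hinv'.push (by simp) _)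
    rwa [Nat.succ_mul]
  obtain ⟨-, hfin, hcase⟩ := key
  rcases Nat.eq_zero_or_pos ((pushAll.run E h).var .current) with h0 | h0
  · rw [h0] at hfin
    exact Or.inl ⟨h0, hfin.isMatching⟩
  refine Or.inr ⟨h0.ne', ?_⟩
  obtain ⟨w, hw⟩ : ∃ w, (pushAll.run E h).var .current = w + 1 :=
    ⟨(pushAll.run E h).var .current - 1, by omega⟩
  -- If the sum of the heights has reached n², then all heights equal n, because none exceeds n; so
  -- this case is blocked too.
  have hstuck : ∀ i, E.Wants k i w → E.n ≤ (pushAll.run E h).arr .height i := by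
    rcases hcase with hc | ⟨v, hv, hall⟩ | hsum
    · omega
    · obtain rfl : v = w := by omega
      exact hall
    · intro i hi
      by_contra hlt
      have hmem := Finset.mem_range.2 hi.1
      have : ∑ i ∈ Finset.range E.n, (pushAll.run E h).arr .height i <
          ∑ i ∈ Finset.range E.n, E.n :=
        Finset.sum_lt_sum (fun j hj => hfin.height_le j (Finset.mem_range.1 hj))
          ⟨i, hmem, not_le.1 hlt⟩
      rw [Finset.sum_const, Finset.card_range, smul_eq_mul] at this
      omega
  rw [hw] at hfin
  exact hfin.exists_card_lt (fun j v hj => hj.1) hstuck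

theorem run_save (E : Env) (h : Store) :
    ∀ i < E.n, (save.run E h).arr .backup i = h.arr .holding i ∧ (save.run E h).arr .height i = 0 :=
  by
  rw [save]
  refine run_upTo_induction E (b := .players) (by decide) (fun j h' => ∀ i < j,
    h'.arr .backup i = h.arr .holding i ∧ h'.arr .height i = 0) _ (by simp) ?_
  intro j h' _ hplayer _ harr hinv i hi
  have hhold : h'.arr .holding = h.arr .holding := harr _ (by decide)
  rcases Nat.lt_succ_iff_lt_or_eq.1 hi with hi | rfl
  · simpa [hplayer, hi.ne] using hinv i hi
  · simp [hplayer, hhold]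

theorem run_restore (E : Env) (h : Store) :
    ∀ i < E.n, (restore.run E h).arr .holding i = h.arr .backup i := by
  rw [restore]
  refine run_upTo_induction E (b := .players) (by decide) (fun j h' => ∀ i < j,
    h'.arr .holding i = h.arr .backup i) _ (by simp) ?_
  intro j h' _ hplayer _ harr hinv i hi
  have hback : h'.arr .backup = h.arr .backup := harr _ (by decide)
  rcases Nat.lt_succ_iff_lt_or_eq.1 hi with hi | rfl
  · simpa [hplayer, hi.ne] using hinv i hi
  · simp [hplayer, hback]

/-- The selected item is either added to the matched items, or Hall's condition fails. -/
theorem run_process (E : Env) (h : Store) {k v : ℕ} {S : Finset ℕ} (hk : h.var .owner = k)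
    (hbest : h.var .best = v + 1) (hS : IsMatching E.n (E.Wants k) (h.arr .holding) S)
    (hv : v ∉ S) :
    (process.run E h).arr .done = Function.update (h.arr .done) v 1 ∧
    ((IsMatching E.n (E.Wants k) ((process.run E h).arr .holding) (insert v S) ∧
      (process.run E h).var .numer = h.var .numer * E.den k v + h.var .denom * E.num k v ∧
      (process.run E h).var .denom = h.var .denom * E.den k v ∧
      (process.run E h).var .count = h.var .count + 1) ∨
    (IsMatching E.n (E.Wants k) ((process.run E h).arr .holding) S ∧
      (∃ D : Finset ℕ, D.card < (captured (E.Wants k) D (insert v S)).card) ∧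
      (process.run E h).var .numer = h.var .numer ∧
      (process.run E h).var .denom = h.var .denom ∧
      (process.run E h).var .count = h.var .count)) := by
  set h₁ := (SProg.store .done (Var.best - 1) 1).run E h with hh₁
  set h₂ := save.run E h₁ with hh₂
  set h₃ := (SProg.set .current Var.best).run E h₂ with hh₃
  set h₄ := pushAll.run E h₃ with hh₄
  have hproc : process.run E h = (SProg.ite Var.current restore record).run E h₄ := rfl
  have hvar : ∀ y, y ≠ .current → y ∉ save.vars → y ∉ pushAll.vars → h₄.var y = h.var y := by
    intro y h0 hy hy'
    rw [hh₄, run_var_of_notMem E hy', hh₃, run_set, Store.setVar_var, if_neg h0, hh₂,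
      run_var_of_notMem E hy]
    rfl
  have hdone : h₄.arr .done = Function.update (h.arr .done) v 1 := by
    rw [hh₄, run_arr_of_notMem E (by decide), hh₃, run_set, Store.setVar_arr, hh₂,
      run_arr_of_notMem E (by decide), hh₁]
    simp [hbest]
  have hhold : h₃.arr .holding = h.arr .holding := by
    rw [hh₃, run_set, Store.setVar_arr, hh₂, run_arr_of_notMem E (by decide), hh₁]
    simp
  have hown : h₃.var .owner = k := by
    rw [hh₃, run_set, Store.setVar_var, if_neg (by decide), hh₂, run_var_of_notMem E (by decide)]
    exact hk
  have hcur : h₃.var .current = v + 1 := by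
    rw [hh₃, run_set, Store.setVar_var, if_pos rfl, SExpr.eval_var, hh₂,
      run_var_of_notMem E (by decide)]
    exact hbest
  have hback : ∀ i < E.n, h₄.arr .backup i = h.arr .holding i := by
    intro i hi
    rw [hh₄, run_arr_of_notMem E (by decide), hh₃, run_set, Store.setVar_arr, hh₂,
      (run_save E h₁ i hi).1, hh₁]
    simp
  have hins := Insertion.start (height := h₃.arr .height) hS hv
    (fun i hi => (run_save E h₁ i hi).2)
  rw [← hcur, ← hhold] at hins
  have howner : h₄.var .owner = k := (hvar _ (by decide) (by decide) (by decide)).trans hk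
  have hbest' : h₄.var .best = v + 1 := (hvar _ (by decide) (by decide) (by decide)).trans hbest
  have hnumer : h₄.var .numer = h.var .numer := hvar _ (by decide) (by decide) (by decide)
  have hdenom : h₄.var .denom = h.var .denom := hvar _ (by decide) (by decide) (by decide)
  have hcount : h₄.var .count = h.var .count := hvar _ (by decide) (by decide) (by decide)
  rw [hproc]
  rcases run_pushAll E h₃ hown hins with ⟨hz, hm⟩ | ⟨hnz, hD⟩
  · rw [run_ite_neg (by simpa using hz)]
    refine ⟨(run_arr_of_notMem E (by decide) h₄).trans hdone, Or.inl ⟨?_, ?_, ?_, ?_⟩⟩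
    · rw [run_arr_of_notMem E (by decide) h₄]; exact hm
    all_goals simp [record, howner, hbest', hnumer, hdenom, hcount]
  · rw [run_ite_pos (by simpa using hnz)]
    refine ⟨(run_arr_of_notMem E (by decide) h₄).trans hdone, Or.inr ⟨?_, hD, ?_, ?_, ?_⟩⟩
    · exact hS.congr fun i hi => (run_restore E h₄ i hi).trans (hback i hi)
    · exact (run_var_of_notMem E (by decide) h₄).trans hnumer
    · exact (run_var_of_notMem E (by decide) h₄).trans hdenom
    · exact (run_var_of_notMem E (by decide) h₄).trans hcount

/-! ### The greedy loop for a fixed owner -/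

/-- Loop invariant for the greedy algorithm after `j` rounds. -/
def GreedyInv (E : Env) (c k j : ℕ) (h : Store) : Prop :=
  ∃ X S : Finset ℕ, X ⊆ (Finset.range E.m).erase c ∧
    (∀ w < E.m, h.arr .done w = 0 ↔ w ≠ c ∧ w ∉ X) ∧
    (∀ w ∈ X, ∀ w' < E.m, w' ≠ c → w' ∉ X → E.cost k w ≤ E.cost k w') ∧
    IsMatching E.n (E.Wants k) (h.arr .holding) S ∧
    IsGreedy (E.Wants k) (E.cost k) X S ∧
    h.var .count = S.card ∧ 0 < h.var .denom ∧
    (h.var .numer : ℚ) / h.var .denom = ∑ w ∈ S, E.cost k w ∧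
    (X = (Finset.range E.m).erase c ∨ j ≤ X.card)

theorem GreedyInv.round {E : Env} {c k j : ℕ} {h : Store} (hden : ∀ w < E.m, 0 < E.den k w)
    (hk : h.var .owner = k) (hh : GreedyInv E c k j h) :
    GreedyInv E c k (j + 1) ((SProg.seq select (.ite Var.best process .skip)).run E h) := by
  obtain ⟨X, S, hX, hdone, hsorted, hm, hg, hcount, hpos, hsum, hprog⟩ := hh
  have a₁ : (select.run E h).arr = h.arr :=
    funext fun a => run_arr_of_notMem E (by cases a <;> decide) h
  have a₂ : (select.run E h).var .owner = k := (run_var_of_notMem E (by decide) h).trans hk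
  have a₃ : (select.run E h).var .count = h.var .count := run_var_of_notMem E (by decide) h
  have a₄ : (select.run E h).var .numer = h.var .numer := run_var_of_notMem E (by decide) h
  have a₅ : (select.run E h).var .denom = h.var .denom := run_var_of_notMem E (by decide) h
  rw [run_seq]
  rcases run_select E h (by rwa [hk]) with ⟨hb, hall⟩ | ⟨v, hvm, hb, hdv, hmin⟩
  · rw [run_ite_neg (by simpa using hb), run_skip, GreedyInv, a₁, a₃, a₄, a₅]
    refine ⟨X, S, hX, hdone, hsorted, hm, hg, hcount, hpos, hsum, Or.inl ?_⟩
    refine hX.antisymm fun w hw => ?_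
    obtain ⟨hwc, hwm⟩ := Finset.mem_erase.1 hw
    by_contra hwX
    exact hall w (Finset.mem_range.1 hwm) ((hdone w (Finset.mem_range.1 hwm)).2 ⟨hwc, hwX⟩)
  rw [run_ite_pos (by simp [hb])]
  rw [hk] at hmin
  obtain ⟨hvc, hvX⟩ := (hdone v hvm).1 hdv
  have hvS : v ∉ S := fun h => hvX (hg.subset h)
  obtain ⟨hd, hcase⟩ := run_process E (select.run E h) a₂ hb (by rwa [a₁]) hvS
  rw [a₃, a₄, a₅] at hcase
  rw [a₁] at hd
  have hX' : insert v X ⊆ (Finset.range E.m).erase c :=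
    Finset.insert_subset (by simp [hvc, hvm]) hX
  have hdone' : ∀ w < E.m, (process.run E (select.run E h)).arr .done w = 0 ↔
      w ≠ c ∧ w ∉ insert v X := by
    intro w hw
    rw [hd]
    by_cases hwv : w = v
    · subst hwv; simp
    · rw [Function.update_of_ne hwv, hdone w hw, Finset.mem_insert]
      simp [hwv]
  have hsorted' : ∀ w ∈ insert v X, ∀ w' < E.m, w' ≠ c → w' ∉ insert v X →
      E.cost k w ≤ E.cost k w' := by
    intro w hw w' hw' hc' hX''
    rw [Finset.mem_insert, not_or] at hX''
    rcases Finset.mem_insert.1 hw with rfl | hw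
    · exact hmin w' hw' ((hdone w' hw').2 ⟨hc', hX''.2⟩)
    · exact hsorted w hw w' hw' hc' hX''.2
  have hprog' : insert v X = (Finset.range E.m).erase c ∨ j + 1 ≤ (insert v X).card := by
    right
    rw [Finset.card_insert_of_notMem hvX]
    rcases hprog with rfl | hj
    · exact absurd (by simp [hvc, hvm]) hvX
    · omega
  have hdv : 0 < E.den k v := hden v hvm
  rcases hcase with ⟨hm', hn', hd', hc'⟩ | ⟨hm', hD, hn', hd', hc'⟩
  · refine ⟨insert v X, insert v S, hX', hdone', hsorted', hm', hg.accept v, ?_, ?_, ?_, hprog'⟩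
    · rw [hc', hcount, Finset.card_insert_of_notMem hvS]
    · rw [hd']; exact Nat.mul_pos hpos hdv
    · rw [hn', hd', Finset.sum_insert hvS, ← hsum, Env.cost]
      have h₁ : (h.var .denom : ℚ) ≠ 0 := by exact_mod_cast hpos.ne'
      have h₂ : (E.den k v : ℚ) ≠ 0 := by exact_mod_cast hdv.ne'
      push_cast
      field_simp
      ring
  · refine ⟨insert v X, S, hX', hdone', hsorted', hm', hg.reject hm.hallCondition ?_ hD, ?_, ?_, ?_,
      hprog'⟩
    -- A rejection certificate needs the items to come in order of cost; that is the sortedness part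
    -- of the invariant.
    · exact fun w hw => hsorted w hw v hvm hvc hvX
    · rw [hc', hcount]
    · rwa [hd']
    · rw [hn', hd', hsum]

theorem run_reset (E : Env) (h : Store) {c k : ℕ} (hc : h.var .center = c) :
    GreedyInv E c k 0 (reset.run E h) := by
  set h₁ := (SProg.upTo .player .players (.store .holding Var.player 0)).run E h with hh₁
  set h₂ := (SProg.upTo .item .items (.store .done Var.item 0)).run E h₁ with hh₂
  have z₁ : ∀ i < E.n, h₁.arr .holding i = 0 := by
    refine run_upTo_induction E (b := .players) (by decide) (fun j h' => ∀ i < j,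
      h'.arr .holding i = 0) _ (by simp) ?_
    intro j h' _ hplayer _ _ hinv i hi
    rcases Nat.lt_succ_iff_lt_or_eq.1 hi with hi | rfl
    · simpa [hplayer, hi.ne] using hinv i hi
    · simp [hplayer]
  have z₂ : ∀ w < E.m, h₂.arr .done w = 0 := by
    refine run_upTo_induction E (b := .items) (by decide) (fun j h' => ∀ i < j,
      h'.arr .done i = 0) _ (by simp) ?_
    intro j h' _ hitem _ _ hinv i hi
    rcases Nat.lt_succ_iff_lt_or_eq.1 hi with hi | rfl
    · simpa [hitem, hi.ne] using hinv i hi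
    · simp [hitem]
  have hc₂ : h₂.var .center = c := by
    rw [hh₂, run_var_of_notMem E (by decide), hh₁, run_var_of_notMem E (by decide), hc]
  have hrun : reset.run E h = (((h₂.setArr .done c 1).setVar .numer 0).setVar .denom 1).setVar
      .count 0 := by rw [← hc₂]; rfl
  rw [hrun]
  refine ⟨∅, ∅, by simp, fun w hw => ?_, by simp, ⟨?_, ?_, ?_⟩, IsGreedy.empty, by simp, by simp,
    by simp, by simp⟩
  · by_cases hwc : w = c
    · subst hwc; simp
    · simp [hwc, z₂ w hw]
  all_goals
    have z₃ : ∀ i < E.n, h₂.arr .holding i = 0 := by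
      rw [hh₂, run_arr_of_notMem E (by decide)]; exact z₁
  · intro i hi w hw
    simp [z₃ i hi] at hw
  · intro i hi j hj h0
    simp [z₃ i hi] at h0
  · intro w
    simp only [Finset.notMem_empty, false_iff, not_exists, not_and]
    intro i hi
    simp [z₃ i hi]

theorem run_greedy (E : Env) (h : Store) {c k : ℕ} (hc : c < E.m) (hk : h.var .owner = k)
    (hden : ∀ w < E.m, 0 < E.den k w) (hh : GreedyInv E c k 0 h) :
    ∃ S : Finset ℕ, IsMatching E.n (E.Wants k) ((greedy.run E h).arr .holding) S ∧
      IsGreedy (E.Wants k) (E.cost k) ((Finset.range E.m).erase c) S ∧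
      (greedy.run E h).var .count = S.card ∧ 0 < (greedy.run E h).var .denom ∧
      ((greedy.run E h).var .numer : ℚ) / (greedy.run E h).var .denom = ∑ w ∈ S, E.cost k w := by
  have key : GreedyInv E c k E.m (greedy.run E h) := by
    refine run_upTo_induction E (b := .items) (by decide) (fun j h' => GreedyInv E c k j h') h
      (by simpa [GreedyInv] using hh) ?_
    intro j h' _ _ hvar _ hinv
    have := hinv.round hden ((hvar _ (by decide)).trans hk)
    simpa [GreedyInv] using this
  obtain ⟨X, S, hX, -, -, hm, hg, hcount, hpos, hsum, hprog⟩ := key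
  have hXeq : X = (Finset.range E.m).erase c := by
    -- There are only `m - 1` leaves, so after `m` rounds the count `m ≤ X.card` is impossible and
    -- all leaves have been processed.
    rcases hprog with h | h
    · exact h
    · have := Finset.card_le_card hX
      rw [Finset.card_erase_of_mem (Finset.mem_range.2 hc), Finset.card_range] at this
      omega
  subst hXeq
  exact ⟨S, hm, hg, hcount, hpos, hsum⟩

/-- Hall's condition for the set of all players except the owner, which captures every item. -/
theorem IsMatching.card_lt {E : Env} {k : ℕ} {f : ℕ → ℕ} {S : Finset ℕ} (hk : k < E.n)
    (h : IsMatching E.n (E.Wants k) f S) : S.card + 1 ≤ E.n := by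
  have h₁ := h.hallCondition ((Finset.range E.n).erase k)
  have h₂ : captured (E.Wants k) ((Finset.range E.n).erase k) S = S :=
    Finset.ext fun w => by
      rw [mem_captured, and_iff_left_iff_imp]
      exact fun _ j hj => Finset.mem_erase.2 ⟨hj.2.1, Finset.mem_range.2 hj.1⟩
  rw [h₂, Finset.card_erase_of_mem (Finset.mem_range.2 hk), Finset.card_range] at h₁
  omega

-- The greedy set decides feasibility: its size is at least that of any feasible set and at most n -
-- 1, and among sets of that size it is a cheapest one.
open Classical in
theorem run_owner_body (E : Env) (h : Store) {c k : ℕ} (hc : c < E.m) (hcenter : h.var .center = c)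
    (hk : h.var .owner = k) (hkn : k < E.n) (hden : ∀ w < E.m, 0 < E.den k w) :
    ((SProg.seq reset (.seq greedy verdict)).run E h).var .answer =
      if E.Feasible c k then 1 else h.var .answer := by
  rw [run_seq, run_seq]
  set h₁ := reset.run E h
  have hk₁ : h₁.var .owner = k := (run_var_of_notMem E (by decide) h).trans hk
  obtain ⟨S, hm, hg, hcount, hpos, hsum⟩ := run_greedy E h₁ hc hk₁ hden (run_reset E h hcenter)
  have hans : (greedy.run E h₁).var .answer = h.var .answer := by
    rw [run_var_of_notMem E (by decide), run_var_of_notMem E (by decide)]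
  set h₂ := greedy.run E h₁
  have hfeas : E.Feasible c k ↔ S.card + 1 = E.n ∧ ∑ w ∈ S, E.cost k w ≤ 1 - 1 / E.n := by
    constructor
    · rintro ⟨f, M, hM, hMX, hMcard, hMsum⟩
      have hle := hg.card_filter_le hM.hallCondition hMX
      have hcard : S.card = M.card := by
        refine le_antisymm (by have := hm.card_lt hkn; omega) ?_
        rcases M.eq_empty_or_nonempty with rfl | hne
        · simp
        -- With the largest cost in `M` as threshold, the comparison of counts becomes a comparison
        -- of sizes.
        obtain ⟨y, -, hy⟩ := M.exists_max_image (E.cost k) hne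
        have := hle (E.cost k y)
        rw [Finset.filter_true_of_mem hy] at this
        exact this.trans (Finset.card_le_card (Finset.filter_subset _ _))
      exact ⟨by omega, (sum_le_sum_of_card_filter_le hcard hle).trans hMsum⟩
    · rintro ⟨h₁, h₂⟩
      exact ⟨_, S, hm, hg.subset, h₁, h₂⟩
  have htest : ∑ w ∈ S, E.cost k w ≤ 1 - 1 / E.n ↔
      E.n * h₂.var .numer + h₂.var .denom ≤ E.n * h₂.var .denom := by
    have hn : (0 : ℚ) < E.n := by exact_mod_cast (Nat.zero_le k).trans_lt hkn
    have hd : (0 : ℚ) < h₂.var .denom := by exact_mod_cast hpos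
    rw [← hsum, div_le_iff₀ hd, ← mul_le_mul_iff_right₀ hn]
    have : (E.n : ℚ) * ((1 - 1 / E.n) * h₂.var .denom) =
        E.n * h₂.var .denom - h₂.var .denom := by field_simp
    rw [this, le_sub_iff_add_le]
    exact_mod_cast Iff.rfl
  rw [hfeas, htest, verdict]
  by_cases e₁ : S.card + 1 = E.n
  · rw [run_ite_neg (by simp [hcount, e₁])]
    by_cases e₂ : E.n * h₂.var .numer + h₂.var .denom ≤ E.n * h₂.var .denom
    · rw [run_ite_neg (by simpa [Nat.sub_eq_zero_iff_le] using e₂), if_pos ⟨e₁, e₂⟩]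
      simp
    · rw [run_ite_pos (by simpa [Nat.sub_eq_zero_iff_le] using e₂), if_neg fun h => e₂ h.2]
      exact hans
  · have e₃ : S.card + 1 - E.n + (E.n - (S.card + 1)) ≠ 0 := by omega
    rw [run_ite_pos (by simpa only [SExpr.eval_add, SExpr.eval_sub, SExpr.eval_var,
      SExpr.eval_bound, Bound.val_players, SExpr.eval_ofNat, hcount] using e₃),
      if_neg fun h => e₁ h.1]
    exact hans

open Classical in
theorem run_decideProg (E : Env) (h : Store) {c : ℕ} (hc : c < E.m)
    (hcenter : (findCenter.run E h).var .center = c)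
    (hden : ∀ k < E.n, ∀ w < E.m, 0 < E.den k w) :
    (decideProg.run E h).var .answer =
      if E.n = 0 ∨ ∃ k < E.n, E.Feasible c k then 1 else 0 := by
  rw [decideProg, run_seq, run_seq]
  set h₁ := findCenter.run E h
  set h₂ := (SProg.ite playersE (.set .answer 0) (.set .answer 1)).run E h₁ with hh₂
  have hc₂ : h₂.var .center = c := (run_var_of_notMem E (by decide) h₁).trans hcenter
  have hans : h₂.var .answer = if E.n = 0 then 1 else 0 := by
    by_cases hn : E.n = 0
    · rw [hh₂, run_ite_neg (by simpa using hn)]; simp [hn]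
    · rw [hh₂, run_ite_pos (by simpa using hn)]; simp [hn]
  refine run_upTo_induction E (b := .players) (by decide) (fun j h' => h'.var .answer =
    if E.n = 0 ∨ ∃ k < j, E.Feasible c k then 1 else 0) h₂ (by simpa using hans) ?_
  intro j h' hj howner hvar _ hinv
  rw [Store.setVar_var, if_neg (by decide), run_owner_body E h' hc
    ((hvar _ (by decide)).trans hc₂) howner hj (hden j hj), hinv]
  by_cases hf : E.Feasible c j
  · rw [if_pos hf, if_pos (Or.inr ⟨j, Nat.lt_succ_self j, hf⟩)]
  · rw [if_neg hf]
    have : (∃ k < j + 1, E.Feasible c k) ↔ ∃ k < j, E.Feasible c k := by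
      constructor
      · rintro ⟨k, hk, hfk⟩
        rcases Nat.lt_succ_iff_lt_or_eq.1 hk with hk | rfl
        exacts [⟨k, hk, hfk⟩, absurd hfk hf]
      · rintro ⟨k, hk, hfk⟩
        exact ⟨k, by omega, hfk⟩
    simp only [this]

end StarCFD

/-! ### Reading the encoding of an instance -/

namespace StarCFD

open RAM SProg

theorem getD_flatMap {α : Type*} (l : List α) (f : α → List ℕ) (L : ℕ)
    (hf : ∀ a, (f a).length = L) {j r : ℕ} (hj : j < l.length) (hr : r < L) :
    (l.flatMap f).getD (j * L + r) 0 = (f l[j]).getD r 0 := by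
  induction l generalizing j with
  | nil => simp at hj
  | cons a l ih =>
    rw [List.flatMap_cons]
    cases j with
    | zero =>
      rw [zero_mul, zero_add, List.getD_append _ _ _ _ (by rw [hf]; exact hr)]
      rfl
    | succ j =>
      have hle : (f a).length ≤ (j + 1) * L + r := by rw [hf, Nat.succ_mul]; omega
      rw [List.getD_append_right _ _ _ _ hle, hf,
        show (j + 1) * L + r - L = j * L + r by rw [Nat.succ_mul]; omega]
      exact ih (by simpa using hj)

theorem length_flatMap_const {α : Type*} (l : List α) (f : α → List ℕ) (L : ℕ)
    (hf : ∀ a, (f a).length = L) : (l.flatMap f).length = l.length * L := by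
  simp [List.length_flatMap, hf]

end StarCFD

namespace CFDInstance

open StarCFD RAM

/-- The environment in which the algorithm runs. -/
noncomputable def env (I : CFDInstance) : Env := ⟨I.n, I.m, I.encode⟩

open Classical in
/-- The adjacency matrix part of the encoding. -/
noncomputable def encodeAdj (I : CFDInstance) : List ℕ :=
  (List.finRange I.m).flatMap fun v =>
    (List.finRange I.m).map fun w => if I.G.Adj v w then 1 else 0

/-- The utility part of the encoding. -/
noncomputable def encodeUtil (I : CFDInstance) : List ℕ :=
  (List.finRange I.n).flatMap fun i =>
    (List.finRange I.m).flatMap fun v => [(I.u i v).num.toNat, (I.u i v).den]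

theorem encode_eq (I : CFDInstance) : I.encode = [I.n, I.m] ++ I.encodeAdj ++ I.encodeUtil := rfl

theorem length_encodeAdj (I : CFDInstance) : I.encodeAdj.length = I.m * I.m := by
  rw [encodeAdj, length_flatMap_const _ _ I.m (by simp), List.length_finRange]

theorem length_encodeUtil_row (I : CFDInstance) (i : Fin I.n) :
    ((List.finRange I.m).flatMap fun v => [(I.u i v).num.toNat, (I.u i v).den]).length =
      I.m * 2 := by
  rw [length_flatMap_const _ _ 2 (by simp), List.length_finRange]

theorem length_encodeUtil (I : CFDInstance) : I.encodeUtil.length = I.n * (I.m * 2) := by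
  rw [encodeUtil, length_flatMap_const _ _ (I.m * 2) I.length_encodeUtil_row,
    List.length_finRange]

theorem length_encode (I : CFDInstance) :
    I.encode.length = 2 + I.m * I.m + 2 * (I.n * I.m) := by
  rw [encode_eq, List.length_append, List.length_append, length_encodeAdj, length_encodeUtil]
  simp only [List.length_cons, List.length_nil]
  ring

open Classical in
theorem read_adj (I : CFDInstance) (v w : Fin I.m) :
    I.env.read (2 + (v * I.m + w)) = if I.G.Adj v w then 1 else 0 := by
  have hlt : (v : ℕ) * I.m + w < I.m * I.m := by
    have := Nat.mul_le_mul_right I.m (Nat.succ_le_of_lt v.2)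
    rw [Nat.succ_mul] at this
    omega
  have hlen : 2 + ((v : ℕ) * I.m + w) < I.env.input.length := by
    rw [show I.env.input = I.encode from rfl, length_encode]; omega
  rw [Env.read, if_pos hlen, show I.env.input = I.encode from rfl, encode_eq,
    List.getD_append _ _ _ _ (by simp [length_encodeAdj]; omega),
    List.getD_append_right _ _ _ _ (by simp)]
  simp only [List.length_cons, List.length_nil, zero_add, Nat.reduceAdd, Nat.add_sub_cancel_left]
  rw [encodeAdj, getD_flatMap _ _ I.m (by simp) (by simp) w.2]
  rw [List.getD_eq_getElem _ _ (by simp)]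
  simp

theorem getD_encodeUtil (I : CFDInstance) (i : Fin I.n) (v : Fin I.m) {r : ℕ} (hr : r < 2) :
    I.env.read (2 + I.m * I.m + (2 * (i * I.m + v) + r)) =
      [(I.u i v).num.toNat, (I.u i v).den].getD r 0 := by
  have hlt : (i : ℕ) * I.m + v + 1 ≤ I.n * I.m := by
    have := Nat.mul_le_mul_right I.m (Nat.succ_le_of_lt i.2)
    rw [Nat.succ_mul] at this
    omega
  have hlen : 2 + I.m * I.m + (2 * ((i : ℕ) * I.m + v) + r) < I.env.input.length := by
    rw [show I.env.input = I.encode from rfl, length_encode]; omega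
  rw [Env.read, if_pos hlen, show I.env.input = I.encode from rfl, encode_eq,
    List.getD_append_right _ _ _ _ (by simp [length_encodeAdj]; omega)]
  rw [List.length_append, length_encodeAdj]
  simp only [List.length_cons, List.length_nil, zero_add, Nat.reduceAdd, Nat.add_sub_cancel_left]
  rw [show 2 * ((i : ℕ) * I.m + v) + r = i * (I.m * 2) + (v * 2 + r) by ring, encodeUtil,
    getD_flatMap _ _ (I.m * 2) I.length_encodeUtil_row (by simp) (by omega),
    getD_flatMap _ _ 2 (by simp) (by simp) hr]
  simp

theorem env_num (I : CFDInstance) (i : Fin I.n) (v : Fin I.m) :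
    I.env.num i v = (I.u i v).num.toNat :=
  I.getD_encodeUtil i v (r := 0) (by norm_num)

theorem env_den (I : CFDInstance) (i : Fin I.n) (v : Fin I.m) : I.env.den i v = (I.u i v).den := by
  have := I.getD_encodeUtil i v (r := 1) (by norm_num)
  rw [show 2 + I.m * I.m + (2 * ((i : ℕ) * I.m + v) + 1) =
    3 + I.m * I.m + 2 * ((i : ℕ) * I.m + v) by ring] at this
  exact this

theorem env_cost (I : CFDInstance) (i : Fin I.n) (v : Fin I.m) : I.env.cost i v = I.u i v := by
  have h : ((I.u i v).num.toNat : ℤ) = (I.u i v).num :=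
    Int.toNat_of_nonneg (Rat.num_nonneg.2 (I.u_nonneg i v))
  rw [Env.cost, env_num, env_den]
  have h' : (((I.u i v).num.toNat : ℕ) : ℚ) = ((I.u i v).num : ℚ) := by exact_mod_cast h
  rw [h', Rat.num_div_den]

theorem env_den_pos (I : CFDInstance) : ∀ k < I.env.n, ∀ w < I.env.m, 0 < I.env.den k w := by
  intro k hk w hw
  have := I.env_den ⟨k, hk⟩ ⟨w, hw⟩
  simp only at this
  rw [this]
  exact Rat.den_pos _

theorem env_wants (I : CFDInstance) (k : ℕ) (i : Fin I.n) (v : Fin I.m) :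
    I.env.Wants k i v ↔ (i : ℕ) ≠ k ∧ 1 / (I.n : ℚ) ≤ I.u i v := by
  have hn : (0 : ℚ) < I.n := by exact_mod_cast (Nat.zero_le _).trans_lt i.2
  have hd : (0 : ℚ) < I.env.den i v := by exact_mod_cast I.env_den_pos i i.2 v v.2
  rw [← env_cost, Env.cost, div_le_div_iff₀ hn hd, one_mul, mul_comm (I.env.num i v : ℚ), Env.Wants,
    and_iff_right (show (i : ℕ) < I.env.n from i.2)]
  exact and_congr_right fun _ => by
    rw [show I.env.n = I.n from rfl]; exact_mod_cast Iff.rfl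

/-! ### The center of the star -/

-- The sum of the neighbors of item 0 is the center if 0 is a leaf, as 0 then has a single neighbor;
-- degree at least 2 means that 0 is itself the center. The center found may differ from a given
-- one, since both ends of a single edge are centers.
open Classical in
theorem run_findCenter (I : CFDInstance) (h : Store) (hI : I.IsStar) :
    ∃ c : Fin I.m, I.G = SimpleGraph.starGraph c ∧ (findCenter.run I.env h).var .center = c := by
  obtain ⟨c, hc⟩ := hI
  have hm : 0 < I.m := (Nat.zero_le _).trans_lt c.2
  set A : ℕ → ℕ := fun v => I.env.read (2 + v) with hA
  have hAval : ∀ v : Fin I.m, A v = if (⟨0, hm⟩ : Fin I.m) ≠ v ∧ (⟨0, hm⟩ = c ∨ v = c) then 1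
      else 0 := by
    intro v
    have := I.read_adj ⟨0, hm⟩ v
    simp only [zero_mul, zero_add, hc, SimpleGraph.starGraph_adj] at this
    exact this
  set h₁ := (SProg.upTo .item .items <|
    .seq (.set .center (Var.center + Var.item * .inp (2 + Var.item)))
      (.set .degree (Var.degree + .inp (2 + Var.item)))).run I.env
      ((h.setVar .center 0).setVar .degree 0) with hh₁
  have hloop : h₁.var .center = ∑ v ∈ Finset.range I.m, v * A v ∧
      h₁.var .degree = ∑ v ∈ Finset.range I.m, A v := by
    refine SProg.run_upTo_induction I.env (b := .items) (by decide) (fun j h' =>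
      h'.var .center = ∑ v ∈ Finset.range j, v * A v ∧
      h'.var .degree = ∑ v ∈ Finset.range j, A v) _ (by simp) ?_
    intro j h' _ hitem _ _ hinv
    simp [hitem, hinv.1, hinv.2, Finset.sum_range_succ, hA]
  have hrun : findCenter.run I.env h =
      (SProg.ite (Var.degree - 1) (.set .center 0) .skip).run I.env h₁ := rfl
  rw [hrun]
  rw [← Fin.sum_univ_eq_sum_range (fun v => v * A v), ← Fin.sum_univ_eq_sum_range] at hloop
  by_cases hc0 : c = ⟨0, hm⟩
  · have hAv : ∀ v : Fin I.m, A v = if v = ⟨0, hm⟩ then 0 else 1 := by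
      intro v
      rw [hAval, hc0]
      by_cases hv : v = ⟨0, hm⟩ <;> simp [hv, eq_comm]
    have hdeg : h₁.var .degree = I.m - 1 := by
      rw [hloop.2, Finset.sum_congr rfl fun v _ => hAv v]
      simp [Finset.sum_ite, Finset.filter_ne']
    -- With center 0 and at most two items the sum is kept: it is 0 for one item, and for two items
    -- it is item 1, an equally valid center.
    by_cases hm3 : I.m - 1 ≤ 1
    · rw [SProg.run_ite_neg (by simpa [hdeg, Nat.sub_eq_zero_iff_le] using hm3), run_skip]
      obtain ⟨n, m, G, u, hu, hs⟩ := I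
      simp only at *
      obtain rfl | rfl : m = 1 ∨ m = 2 := by omega
      · exact ⟨c, hc, by rw [hloop.1, hc0]; simp⟩
      · refine ⟨1, ?_, ?_⟩
        · rw [hc, hc0]
          ext x y
          fin_cases x <;> fin_cases y <;> simp
        · rw [hloop.1, Fin.sum_univ_two, hAv, hAv]
          simp
    · refine ⟨c, hc, ?_⟩
      rw [SProg.run_ite_pos (by simpa [hdeg, Nat.sub_eq_zero_iff_le] using hm3)]
      simp [hc0]
  · have hAv : ∀ v : Fin I.m, A v = if v = c then 1 else 0 := by
      intro v
      rw [hAval]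
      by_cases hv : v = c
      · subst hv; simp [Ne.symm hc0]
      · simp [hv, Ne.symm hc0]
    have hdeg : h₁.var .degree = 1 := by
      rw [hloop.2, Finset.sum_congr rfl fun v _ => hAv v]; simp
    refine ⟨c, hc, ?_⟩
    rw [SProg.run_ite_neg (by simp [hdeg]), run_skip, hloop.1,
      Finset.sum_congr rfl fun v _ => by rw [hAv v]]
    simp

/-! ### Proportional allocations on stars -/

/-- A nontrivial walk inside `X` starts with an edge, and each edge of a star contains the center.
-/
theorem eq_of_mem_of_center_notMem {m : ℕ} {c : Fin m} {X : Finset (Fin m)} (hc : c ∉ X)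
    (hX : ((SimpleGraph.starGraph c).induce (X : Set (Fin m))).Preconnected) {x y : Fin m}
    (hx : x ∈ X) (hy : y ∈ X) : x = y := by
  obtain ⟨p⟩ := hX ⟨x, hx⟩ ⟨y, hy⟩
  cases p with
  | nil => rfl
  | @cons _ z _ hadj _ =>
    have := hadj
    simp only [SimpleGraph.comap_adj, Function.Embedding.subtype_apply,
      SimpleGraph.starGraph_adj] at this
    rcases this.2 with h | h
    · exact absurd (h ▸ hx) hc
    · exact absurd (h ▸ z.2) hc

theorem preconnected_of_center_mem {m : ℕ} {c : Fin m} {X : Finset (Fin m)} (hc : c ∈ X) :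
    ((SimpleGraph.starGraph c).induce (X : Set (Fin m))).Preconnected := by
  have key : ∀ x : (X : Set (Fin m)),
      ((SimpleGraph.starGraph c).induce (X : Set (Fin m))).Reachable ⟨c, hc⟩ x := by
    intro x
    by_cases hx : (x : Fin m) = c
    · rw [show x = ⟨c, hc⟩ from Subtype.ext hx]
    · refine SimpleGraph.Adj.reachable ?_
      simp [Ne.symm hx]
  exact fun x y => (key x).symm.trans (key y)

theorem feasible_of_propCFD (I : CFDInstance) {c : Fin I.m} (hc : I.G = SimpleGraph.starGraph c)
    (hn : 0 < I.n) (h : I.PropCFD) : ∃ k < I.n, I.env.Feasible c k := by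
  obtain ⟨π, ⟨hconn, hdisj⟩, hprop⟩ := h
  have hn' : (0 : ℚ) < 1 / I.n := by positivity
  -- If nobody holds the center, any player can serve as the owner.
  obtain ⟨k, hk⟩ : ∃ k : Fin I.n, ∀ i, i ≠ k → c ∉ π i := by
    by_cases hex : ∃ k, c ∈ π k
    · obtain ⟨k, hk⟩ := hex
      exact ⟨k, fun i hi hci => Finset.disjoint_left.1 (hdisj i k hi) hci hk⟩
    · push Not at hex
      exact ⟨⟨0, hn⟩, fun i _ => hex i⟩
  have hne : ∀ i, ∃ w, w ∈ π i := by
    intro i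
    by_contra hemp
    push Not at hemp
    have := hprop i
    rw [value, Finset.eq_empty_of_forall_notMem hemp, Finset.sum_empty] at this
    exact absurd this (not_le.2 hn')
  choose w hw using hne
  have hsing : ∀ i, i ≠ k → π i = {w i} := by
    intro i hi
    refine Finset.eq_singleton_iff_unique_mem.2 ⟨hw i, fun x hx => ?_⟩
    have := hconn i
    rw [hc] at this
    exact eq_of_mem_of_center_notMem (hk i hi) this hx (hw i)
  have hwinj : ∀ i j, w i = w j → i = j := by
    intro i j hij
    by_contra hne
    exact Finset.disjoint_left.1 (hdisj i j hne) (hw i) (hij ▸ hw j)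
  have hwk : ∀ i, i ≠ k → w i ∉ π k := fun i hi h =>
    Finset.disjoint_left.1 (hdisj i k hi) (hw i) h
  set f : ℕ → ℕ := fun i => if hi : i < I.n then if i = k then 0 else w ⟨i, hi⟩ + 1 else 0 with hf
  have hfval : ∀ (i : Fin I.n), f i = if i = k then 0 else (w i : ℕ) + 1 := by
    intro i
    simp [hf, Fin.ext_iff]
  set S : Finset ℕ := (Finset.univ.erase k).image fun i => (w i : ℕ) with hS
  have hinjOn : Set.InjOn (fun i => (w i : ℕ)) (Finset.univ.erase k : Finset (Fin I.n)) :=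
    fun i _ j _ hij => hwinj i j (Fin.ext hij)
  refine ⟨k, k.2, f, S, ⟨?_, ?_, ?_⟩, ?_, ?_, ?_⟩
  · intro i hi v hv
    have h₁ := hfval ⟨i, hi⟩
    simp only at h₁
    rw [hv] at h₁
    split_ifs at h₁ with hik
    · obtain rfl : v = w ⟨i, hi⟩ := by omega
      refine (I.env_wants k ⟨i, hi⟩ (w ⟨i, hi⟩)).2 ⟨fun h => hik (Fin.ext h), ?_⟩
      have := hprop ⟨i, hi⟩
      rwa [value, hsing _ hik, Finset.sum_singleton] at this
  · intro i hi j hj h0 heq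
    have h₁ := hfval ⟨i, hi⟩
    have h₂ := hfval ⟨j, hj⟩
    simp only at h₁ h₂
    rw [h₁] at h0 heq
    rw [h₂] at heq
    split_ifs at h0 heq with h₃ h₄
    · omega
    · exact Fin.mk.inj_iff.1 (hwinj _ _ (Fin.ext (Nat.succ_injective heq)))
  · intro v
    simp only [hS, Finset.mem_image, Finset.mem_erase, Finset.mem_univ, and_true]
    constructor
    · rintro ⟨i, hik, rfl⟩
      exact ⟨i, i.2, by rw [hfval, if_neg hik]⟩
    · rintro ⟨i, hi, hv⟩
      have h₁ := hfval ⟨i, hi⟩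
      simp only at h₁
      rw [hv] at h₁
      split_ifs at h₁ with hik
      · exact ⟨⟨i, hi⟩, hik, by omega⟩
  · intro v hv
    obtain ⟨i, hi, rfl⟩ := Finset.mem_image.1 hv
    have hik := (Finset.mem_erase.1 hi).1
    refine Finset.mem_erase.2 ⟨fun h => hk i hik (Fin.ext h ▸ hw i), Finset.mem_range.2 (w i).2⟩
  · rw [hS, Finset.card_image_of_injOn hinjOn, Finset.card_erase_of_mem (Finset.mem_univ _),
      Finset.card_univ, Fintype.card_fin]
    exact Nat.sub_add_cancel hn
  · rw [hS, Finset.sum_image hinjOn]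
    simp only [env_cost]
    have hdis : Disjoint ((Finset.univ.erase k).image w) (π k) := by
      rw [Finset.disjoint_left]
      rintro x hx
      obtain ⟨i, hi, rfl⟩ := Finset.mem_image.1 hx
      exact hwk i (Finset.mem_erase.1 hi).1
    -- The leaves of the other players are disjoint from the owner's bundle, so together they are
    -- worth at most 1 to the owner.
    have hsum : ∑ i ∈ Finset.univ.erase k, I.u k (w i) + I.value k (π k) ≤ 1 := by
      rw [← I.u_sum k, value, ← Finset.sum_image (f := fun v => I.u k v) (g := w)
        (fun i _ j _ hij => hwinj i j hij), ← Finset.sum_union hdis]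
      exact Finset.sum_le_univ_sum_of_nonneg (fun v => I.u_nonneg k v)
    have := hprop k
    change _ ≤ 1 - 1 / (I.n : ℚ)
    linarith

theorem propCFD_of_feasible (I : CFDInstance) {c : Fin I.m} (hc : I.G = SimpleGraph.starGraph c)
    (k : Fin I.n) (h : I.env.Feasible c k) : I.PropCFD := by
  obtain ⟨f, S, hm, hS, hcard, hsum⟩ := h
  have hfk : f k = 0 := by
    by_contra h0
    exact (hm.wants k k.2 (f k - 1) (by omega)).2.1 rfl
  have hsurj : ∀ i : Fin I.n, i ≠ k → f i ≠ 0 := by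
    have hex : ∀ w ∈ S, ∃ i < I.n, f i = w + 1 := fun w hw => (hm.mem_iff w).1 hw
    choose! g hgn hg using hex
    have hsub : S.image g ⊆ (Finset.range I.n).erase k := by
      intro i hi
      obtain ⟨w, hw, rfl⟩ := Finset.mem_image.1 hi
      refine Finset.mem_erase.2 ⟨fun h => ?_, Finset.mem_range.2 (hgn w hw)⟩
      have := hg w hw
      rw [h, hfk] at this
      omega
    have hinj : Set.InjOn g S := by
      intro w hw w' hw' heq
      have h₁ := hg w hw
      rw [heq, hg w' hw'] at h₁
      omega
    -- The `n - 1` items of `S` have distinct holders, none of them the owner, so every other player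
    -- holds an item.
    have heq : S.image g = (Finset.range I.n).erase k := by
      refine Finset.eq_of_subset_of_card_le hsub ?_
      rw [Finset.card_image_of_injOn hinj, Finset.card_erase_of_mem (Finset.mem_range.2 k.2),
        Finset.card_range]
      have : S.card + 1 = I.n := hcard
      omega
    intro i hi
    have hmem : (i : ℕ) ∈ S.image g := by
      rw [heq]
      exact Finset.mem_erase.2 ⟨fun h => hi (Fin.ext h), Finset.mem_range.2 i.2⟩
    obtain ⟨w, hw, hwi⟩ := Finset.mem_image.1 hmem
    rw [← hwi, hg w hw]
    omega
  have hitem : ∀ i : Fin I.n, i ≠ k → ∃ w : Fin I.m, f i = w + 1 ∧ (w : ℕ) ∈ S := by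
    intro i hi
    have h0 := hsurj i hi
    have hmem : f i - 1 ∈ S := (hm.mem_iff _).2 ⟨i, i.2, by omega⟩
    have hlt := Finset.mem_range.1 (Finset.mem_erase.1 (hS hmem)).2
    exact ⟨⟨f i - 1, hlt⟩, by simp only; omega, hmem⟩
  have : Nonempty (Fin I.m) := ⟨c⟩
  choose! w hw hwS using hitem
  -- The owner receives all unmatched items; this bundle contains the center and is therefore
  -- connected.
  set R : Finset (Fin I.m) := Finset.univ.filter fun v => (v : ℕ) ∉ S with hR
  have hcR : c ∈ R := by
    simp only [hR, Finset.mem_filter, Finset.mem_univ, true_and]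
    exact fun h => (Finset.mem_erase.1 (hS h)).1 rfl
  have hwR : ∀ i, i ≠ k → w i ∉ R := fun i hi h => (Finset.mem_filter.1 h).2 (hwS i hi)
  refine ⟨fun i => if i = k then R else {w i}, ⟨fun i => ?_, fun i j hij => ?_⟩, fun i => ?_⟩
  · by_cases hi : i = k
    · rw [hc]
      exact preconnected_of_center_mem (by simpa [hi] using hcR)
    · have : Subsingleton ((if i = k then R else {w i} : Finset (Fin I.m)) : Set (Fin I.m)) := by
        rw [if_neg hi, Finset.coe_singleton]; infer_instance
      exact SimpleGraph.Preconnected.of_subsingleton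
  · by_cases hi : i = k
    · have hj : j ≠ k := fun h => hij (hi.trans h.symm)
      simpa only [if_pos hi, if_neg hj, Finset.disjoint_singleton_right] using hwR j hj
    · by_cases hj : j = k
      · simpa only [if_neg hi, if_pos hj, Finset.disjoint_singleton_left] using hwR i hi
      · simp only [if_neg hi, if_neg hj, Finset.disjoint_singleton]
        intro heq
        have h₁ := hw i hi
        rw [heq, ← hw j hj] at h₁
        exact hij (Fin.ext (hm.inj i i.2 j j.2 (hsurj i hi) h₁))
  · by_cases hi : i = k
    · subst hi
      simp only [if_true, value]
      have hSsum : ∑ v ∈ S, I.env.cost i v =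
          ∑ v ∈ Finset.univ.filter (fun v : Fin I.m => (v : ℕ) ∈ S), I.u i v := by
        have hmap : S = (Finset.univ.filter (fun v : Fin I.m => (v : ℕ) ∈ S)).map
            Fin.valEmbedding := by
          ext v
          simp only [Finset.mem_map, Finset.mem_filter, Finset.mem_univ, true_and,
            Fin.valEmbedding_apply]
          constructor
          · intro hv
            exact ⟨⟨v, Finset.mem_range.1 (Finset.mem_erase.1 (hS hv)).2⟩, hv, rfl⟩
          · rintro ⟨v, hv, rfl⟩
            exact hv
        conv_lhs => rw [hmap]
        rw [Finset.sum_map]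
        exact Finset.sum_congr rfl fun v _ => I.env_cost i v
      have htot := I.u_sum i
      rw [← Finset.sum_filter_add_sum_filter_not Finset.univ (fun v : Fin I.m => (v : ℕ) ∈ S),
        ← hSsum] at htot
      change _ ≤ 1 - 1 / (I.n : ℚ) at hsum
      linarith
    · simp only [if_neg hi, value, Finset.sum_singleton]
      exact ((I.env_wants k i (w i)).1 (hm.wants i i.2 _ (hw i hi))).2

theorem propCFD_iff (I : CFDInstance) {c : Fin I.m} (hc : I.G = SimpleGraph.starGraph c) :
    I.PropCFD ↔ I.n = 0 ∨ ∃ k < I.n, I.env.Feasible c k := by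
  constructor
  · intro h
    rcases Nat.eq_zero_or_pos I.n with h0 | hpos
    · exact Or.inl h0
    · exact Or.inr (I.feasible_of_propCFD hc hpos h)
  · rintro (h0 | ⟨k, hk, hf⟩)
    · have : IsEmpty (Fin I.n) := by rw [h0]; infer_instance
      exact ⟨fun _ => ∅, ⟨fun i => isEmptyElim i, fun i => isEmptyElim i⟩, fun i => isEmptyElim i⟩
    · exact I.propCFD_of_feasible hc ⟨k, hk⟩ hf

end CFDInstance

/-! ### The machine -/

namespace StarCFD

open RAM

/-- Load the number of players, the number of items and the length of the input. -/
def prologue : Prog :=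
  .seq (.assign 1 (.load (.lit 0))) <| .seq (.assign 2 (.load (.lit 1))) <|
    .assign 3 (.bin .add (.bin .add (.lit 2) (.bin .mul (.reg 2) (.reg 2)))
      (.bin .mul (.lit 2) (.bin .mul (.reg 1) (.reg 2))))

theorem length_le_inputSize (l : List ℕ) : l.length ≤ inputSize l := by
  induction l with
  | nil => simp
  | cons a l ih =>
    have := len_pos a
    simp only [inputSize, List.map_cons, List.sum_cons, List.length_cons] at *
    omega

theorem len_getD_le (l : List ℕ) (hl : 0 < l.length) (k : ℕ) : len (l.getD k 0) ≤ inputSize l := by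
  rcases lt_or_ge k l.length with hk | hk
  · rw [List.getD_eq_getElem _ _ hk]
    exact List.single_le_sum (by simp) _ (List.mem_map.2 ⟨l[k], List.getElem_mem hk, rfl⟩)
  · rw [List.getD_eq_default _ _ hk]
    have := length_le_inputSize l
    simp only [len, Nat.size_zero]
    omega

theorem bounded_init (l : List ℕ) (hl : 0 < l.length) :
    (init l).Bounded (inputSize l + 1) := by
  refine ⟨fun r => ?_, fun a => (len_getD_le l hl a).trans (Nat.le_succ _)⟩
  simp [init, len]

/-- The cost of an assignment in a bounded state. -/
theorem assign_cost_le {L : ℕ} {s : State} (hL : 1 ≤ L) (hs : s.Bounded L) (r : ℕ) (e : Expr) :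
    e.cost s + len r + len (e.eval s) ≤ (e.costFactor + len r + e.valueFactor) * L := by
  rw [add_mul, add_mul]
  exact add_le_add (add_le_add (e.cost_le hL hs) (Nat.le_mul_of_pos_right _ hL))
    (e.len_eval_le hL hs)

/-- After the prologue the machine represents the instance and the zero store. -/
theorem exec_prologue : ∃ C : ℕ, ∀ I : CFDInstance, 0 < I.m → ∃ t s,
    Exec prologue (init I.encode) t s ∧
    Represents I.env ⟨fun _ => 0, fun _ _ => 0⟩ s ∧ s.Bounded (inputSize I.encode + 1) ∧
    t ≤ C * (inputSize I.encode + 1) := by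
  set e₁ : Expr := .load (.lit 0) with he₁
  set e₂ : Expr := .load (.lit 1) with he₂
  set e₃ : Expr := .bin .add (.bin .add (.lit 2) (.bin .mul (.reg 2) (.reg 2)))
      (.bin .mul (.lit 2) (.bin .mul (.reg 1) (.reg 2))) with he₃
  refine ⟨(e₁.costFactor + len 1 + e₁.valueFactor) + ((e₂.costFactor + len 2 + e₂.valueFactor) +
    (e₃.costFactor + len 3 + e₃.valueFactor)), fun I hm => ?_⟩
  have hlen := I.length_encode
  have hpos : 0 < I.encode.length := by omega
  have hb₀ := bounded_init I.encode hpos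
  set L := inputSize I.encode + 1 with hL
  have hL1 : 1 ≤ L := by omega
  set s₀ := init I.encode with hs₀
  set s₁ := s₀.setReg 1 (e₁.eval s₀) with hs₁
  have hb₁ : s₁.Bounded L := hb₀.setReg (hb₀.2 _)
  set s₂ := s₁.setReg 2 (e₂.eval s₁) with hs₂
  have hb₂ : s₂.Bounded L := hb₁.setReg (hb₁.2 _)
  have v₃ : e₃.eval s₂ = I.encode.length := by
    have r₁ : s₂.reg 1 = I.n := rfl
    have r₂ : s₂.reg 2 = I.m := rfl
    rw [hlen]
    simp only [he₃, Expr.eval, Op.eval, r₁, r₂]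
  set s₃ := s₂.setReg 3 (e₃.eval s₂) with hs₃
  -- The input length, as a number, is at most `inputSize`, so its binary length fits below `L`.
  have hb₃ : s₃.Bounded L := by
    refine hb₂.setReg ?_
    rw [v₃]
    have h₁ := len_le_add_one I.encode.length
    have h₂ := length_le_inputSize I.encode
    omega
  refine ⟨_, s₃, .seq (.assign _ _ _) (.seq (.assign _ _ _) (.assign _ _ _)), ?_, hb₃, ?_⟩
  · refine ⟨?_, ?_, ?_, ?_, ?_⟩
    · intro b
      cases b <;> rfl
    · simp [hs₃, State.setReg, v₃, CFDInstance.env]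
    · intro x
      have h₁ : x.idx + 4 ≠ 1 := by omega
      have h₂ : x.idx + 4 ≠ 2 := by omega
      have h₃ : x.idx + 4 ≠ 3 := by omega
      simp [hs₃, hs₂, hs₁, State.setReg, h₁, h₂, h₃, hs₀, init]
    · intro a _
      rfl
    · intro a i
      exact List.getD_eq_default _ _ (Nat.le_add_right _ _)
  · have c₁ := assign_cost_le hL1 hb₀ 1 e₁
    have c₂ := assign_cost_le hL1 hb₁ 2 e₂
    have c₃ := assign_cost_le hL1 hb₂ 3 e₃
    refine (add_le_add c₁ (add_le_add c₂ c₃)).trans (le_of_eq ?_)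
    ring

end StarCFD

open StarCFD RAM Polynomial in
theorem mainTheorem11 :
    RAM.SolvableInPolyTime CFDInstance.encode CFDInstance.IsStar CFDInstance.PropCFD := by
  classical
  obtain ⟨C, hC⟩ := exec_prologue
  set out : Expr := .reg (Var.answer.idx + 4) with hout
  set c₀ : ℕ := out.costFactor + len 0 + out.valueFactor
  -- The second factor bounds the length of all numbers: `X + 1` after the prologue, and the growth
  -- polynomial times the input size for the rest. The first factor collects the time per unit of
  -- length for prologue, main program and output.
  refine ⟨.seq prologue (.seq decideProg.compile (.assign 0 out)),
    (((C + c₀ : ℕ) : ℕ[X]) + decideProg.time) * (X + 1 + decideProg.growth * X), fun I hI => ?_⟩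
  obtain ⟨c, hc, hcenter⟩ := I.run_findCenter ⟨fun _ => 0, fun _ _ => 0⟩ hI
  have hm : 0 < I.m := (Nat.zero_le _).trans_lt c.2
  obtain ⟨t₁, s₁, hex₁, hr₁, hb₁, ht₁⟩ := hC I hm
  have hlen := I.length_encode
  have hle := length_le_inputSize I.encode
  have hpos : 0 < I.encode.length := by omega
  set N := inputSize I.encode with hN
  -- Since `m > 0`, both `n` and `m` are at most the length of the encoding, so loops bounded by the
  -- values of `n` and `m` are polynomial although these numbers are written in binary.
  have hbound : ∀ b : Bound, b.val I.env ≤ N := by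
    have h₁ : I.m ≤ I.m * I.m := Nat.le_mul_of_pos_right _ hm
    have h₂ : I.n ≤ I.n * I.m := Nat.le_mul_of_pos_right _ hm
    intro b
    cases b
    · change I.n ≤ N; omega
    · change I.m ≤ N; omega
  obtain ⟨t₂, s₂, hex₂, hr₂, hb₂, ht₂⟩ := exec_compile (E := I.env) (N := N) (D := N) hpos hbound
    (by omega) (len_getD_le I.encode hpos) decideProg wellFormed_decideProg _ s₁ (N + 1)
    (by omega) hr₁ hb₁
  have hval : out.eval s₂ = if I.PropCFD then 1 else 0 := by
    have hrun := run_decideProg I.env ⟨fun _ => 0, fun _ _ => 0⟩ c.2 hcenter I.env_den_pos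
    have hvar := hr₂.var .answer
    rw [hrun] at hvar
    rw [hout, Expr.eval, hvar]
    exact if_congr (I.propCFD_iff hc).symm rfl rfl
  refine ⟨_, _, .seq hex₁ (.seq hex₂ (.assign _ _ _)), ?_, fun hQ => ?_, fun hQ => ?_⟩
  · have c₃ := assign_cost_le (by omega) hb₂ 0 out
    simp only [eval_mul, eval_add, eval_natCast, eval_X, eval_one, Nat.cast_id]
    set M := N + 1 + decideProg.growth.eval N * N
    have c₁ := ht₁.trans (Nat.mul_le_mul_left C (show N + 1 ≤ M from Nat.le_add_right _ _))
    rw [show (C + c₀ + decideProg.time.eval N) * M =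
      C * M + (decideProg.time.eval N * M + c₀ * M) by ring]
    exact add_le_add c₁ (add_le_add ht₂ c₃)
  · simp [State.setReg, hval, hQ]
  · simp [State.setReg, hval, hQ]
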